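/- Let $\mathrm{Aut}(T_3)$ be the automorphism group of the rooted ternary tree $T_3$, whose vertices are the finite words over $\{1,2,3\}$. Write $g=(g_1,g_2,g_3)\sigma$ for the automorphism $xw\mapsto \sigma(x)\,g_x(w)$ ($x$ a letter, $w$ a word), and identify $a\in S_3$ with $(1,1,1)a$. The mother group $G_3\le \mathrm{Aut}(T_3)$ is the subgroup generated by $S_3$ and by all automorphisms $b$ defined recursively by $b=(b_1,b_2,b)\sigma$ with $b_1,b_2\in S_3$ and $\sigma\in S_2$ permuting $\{1,2\}$. Define $c=(1,(23),c)$, $t_\emptyset=(23)c(23)c$ and, for every word $v$, $t_{1v}=(t_v,1,1)$, $t_{2v}=(1,t_v,1)$, $t_{3v}=(1,1,t_v)$. Put $T=\langle t_v : v\in\{1,2,3\}^*\rangle$ and $T_n=\langle t_v : |v|\le n\rangle$. A length function on a group $G$ is a map $l:G\to[0,\infty)$ with $l(g)=0\iff g=1$, $l(g^{-1})=l(g)$ and $l(gh)\le l(g)+l(h)$; it is proper if all sets $\{g: l(g)\le R\}$ are finite, and its length metric is $d(g,h)=l(gh^{-1})$. A family of subsets of a metric space is $r$-disjoint if distinct members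 $U,V$ satisfy $\inf\{d(x,y):x\in U,\,y\in V\}>r$. A metric family $\mathcal X$ is $r$-decomposable over a metric family $\mathcal Y$ if every $X\in\mathcal X$ can be written $X=X_0\cup X_1$ with each $X_i$ a union of an $r$-disjoint family of members of $\mathcal Y$. Let $\mathcal D_0$ be the collection of the metric families with uniformly bounded diameters, and for an ordinal $\alpha>0$ let $\mathcal D_\alpha$ be the collection of the families $\mathcal X$ such that for every $r>0$ there are $\beta<\alpha$ and $\mathcal Y\in\mathcal D_\beta$ with $\mathcal X$ $r$-decomposable over $\mathcal Y$. A metric space $X$ is in $\mathcal D_\alpha$ if $\{X\}$ is, and has finite decomposition complexity if it is in $\mathcal D_\alpha$ for some $\alpha$. One has $\mathrm{asdim}\,X\le n$ if for every $r>0$ the space $X$ is a union of $n+1$ subspaces, each of which is a union of an $r$-disjoint family of subsets, with all these subsets of uniformly bounded diameter; $X$ has infinite asymptotic dimension if $\mathrm{asdim}\,X\le n$ for no $n\in\mathbb N$. **Theorem.** $T$ is a subgroup of $G_3$ which admits a proper length function, and for the length metric of every proper length function on $T$: 1. $T$ has finite decomposition complexity; more precisely $T\in\mathcal D_\omega$;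 2. $T$ has infinite asymptotic dimension. Moreover, for every $n\ge 0$ and the length metric of every proper length function on $T_n$, one has $T_n\in\mathcal D_{4^{n+1}}$; and $T$ contains a subgroup isomorphic to the direct sum $\bigoplus_{\mathbb N}\mathbb Z$. -/

import Mathlib

namespace MotherFDC

/-! ### Metric families, decomposition complexity, asymptotic dimension -/

section Coarse

universe u

variable {M : Type u} [MetricSpace M]

/-- The distance `d(U, V) = inf {d(x, y) : x ∈ U, y ∈ V}` of two subsets (`⊤` if one is empty). -/
noncomputable def setDist (U V : Set M) : ENNReal :=
  ⨅ x ∈ U, ⨅ y ∈ V, edist x y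

/-- A collection of subsets is `r`-disjoint if distinct members are at distance `> r`. -/
def RDisjoint (r : ℝ) (𝒰 : Set (Set M)) : Prop :=
  ∀ U ∈ 𝒰, ∀ V ∈ 𝒰, U ≠ V → ENNReal.ofReal r < setDist U V

/-- A collection of subsets is uniformly bounded: its members have uniformly bounded diameter. -/
def UniformlyBounded (𝒰 : Set (Set M)) : Prop :=
  ∃ B : ℝ, ∀ U ∈ 𝒰, ∀ x ∈ U, ∀ y ∈ U, dist x y ≤ B

/-- `𝒳` is `r`-decomposable over `𝒴`: every `A ∈ 𝒳` is `A = A₀ ∪ A₁` where each `Aᵢ` is the union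
of an `r`-disjoint collection of members of `𝒴`.

A metric family is a collection of subspaces (with the induced metric) of one ambient space `M`.
For the complexity of a single space `M` this is no restriction: all pieces of iterated
decompositions of `M` are subspaces of `M`, and members of `𝒴` that are not used as pieces may be
discarded. -/
def Decomposable (r : ℝ) (𝒳 𝒴 : Set (Set M)) : Prop :=
  ∀ A ∈ 𝒳, ∃ A₀ A₁ : Set M, A = A₀ ∪ A₁ ∧
    (∃ 𝒰₀ ⊆ 𝒴, RDisjoint r 𝒰₀ ∧ A₀ = ⋃₀ 𝒰₀) ∧
    (∃ 𝒰₁ ⊆ 𝒴, RDisjoint r 𝒰₁ ∧ A₁ = ⋃₀ 𝒰₁)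

/-- The classes `𝔇_α` of metric families: `𝔇_0` consists of the bounded families, and for `α > 0`
a family is in `𝔇_α` iff for every `r > 0` it is `r`-decomposable over a family in some `𝔇_β`,
`β < α`. -/
def FamilyInD (α : Ordinal.{u}) (𝒳 : Set (Set M)) : Prop :=
  (α = 0 ∧ UniformlyBounded 𝒳) ∨
  (0 < α ∧ ∀ r : ℝ, 0 < r → ∃ β : Ordinal.{u}, ∃ _ : β < α,
    ∃ 𝒴 : Set (Set M), FamilyInD β 𝒴 ∧ Decomposable r 𝒳 𝒴)
termination_by α

variable (M)

/-- The single metric space `M` belongs to `𝔇_α`. -/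
def SpaceInD (α : Ordinal.{u}) : Prop :=
  FamilyInD α ({Set.univ} : Set (Set M))

/-- The metric space `M` has finite decomposition complexity. -/
def HasFDC : Prop :=
  ∃ α : Ordinal.{u}, SpaceInD M α

/-- `asdim M ≤ n`: for every `r > 0`, `M` is covered by `n + 1` subspaces, each of them a union of
an `r`-disjoint collection, all of these collections being uniformly bounded together. -/
def AsdimLE (n : ℕ) : Prop :=
  ∀ r : ℝ, 0 < r → ∃ 𝒰 : Fin (n + 1) → Set (Set M),
    (⋃ i, ⋃₀ 𝒰 i) = Set.univ ∧ (∀ i, RDisjoint r (𝒰 i)) ∧ UniformlyBounded (⋃ i, 𝒰 i)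

/-- `M` has infinite asymptotic dimension. -/
def InfiniteAsdim : Prop :=
  ∀ n : ℕ, ¬ AsdimLE M n

end Coarse

/-! ### Proper length metrics on groups -/

section Length

variable {G : Type*} [Group G]

/-- A length function (group norm) is proper if its balls of finite radius are finite. -/
def IsProperLength (l : GroupNorm G) : Prop :=
  ∀ R : ℝ, {g : G | l g ≤ R}.Finite

/-- The length metric `d(g, h) = l(g h⁻¹)` of a length function. -/
@[reducible] def lengthMetric (l : GroupNorm G) : MetricSpace G where
  dist g h := l (g * h⁻¹)
  dist_self g := by simp
  dist_comm g h := by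
    show l (g * h⁻¹) = l (h * g⁻¹)
    rw [← map_inv_eq_map l (g * h⁻¹)]; simp
  dist_triangle g h k := by
    show l (g * k⁻¹) ≤ l (g * h⁻¹) + l (h * k⁻¹)
    have := map_mul_le_add l (g * h⁻¹) (h * k⁻¹)
    simpa [mul_assoc] using this
  eq_of_dist_eq_zero {g h} hgh := by
    have h1 : g * h⁻¹ = 1 := (map_eq_zero_iff_eq_one l).1 hgh
    exact mul_inv_eq_one.1 h1

end Length

/-! ### Automorphisms of the rooted regular tree of words -/

section Tree

variable {X : Type*}

/-- Two words are joined by an edge iff they are of the form `w` and `wx` with `x` a letter. -/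
def Adj (u v : List X) : Prop :=
  ∃ x : X, v = u ++ [x] ∨ u = v ++ [x]

/-- The automorphism group of the rooted tree of words over `X`: the bijections that preserve the
root and adjacency. -/
def TreeAut (X : Type*) : Subgroup (Equiv.Perm (List X)) where
  carrier := {g | g [] = [] ∧ ∀ u v, Adj (g u) (g v) ↔ Adj u v}
  one_mem' := ⟨rfl, fun _ _ => Iff.rfl⟩
  mul_mem' {g h} hg hh := by
    refine ⟨?_, fun u v => ?_⟩
    · rw [Equiv.Perm.mul_apply, hh.1, hg.1]
    · rw [Equiv.Perm.mul_apply, Equiv.Perm.mul_apply, hg.2, hh.2]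
  inv_mem' {g} hg := by
    refine ⟨?_, fun u v => ?_⟩
    · rw [Equiv.Perm.inv_eq_iff_eq, hg.1]
    · rw [← hg.2]; simp

theorem adj_nil_cons (y : X) (v : List X) : Adj [] (y :: v) ↔ v = [] := by
  simp [Adj]

theorem adj_cons_nil (x : X) (u : List X) : Adj (x :: u) [] ↔ u = [] := by
  simp [Adj]

theorem adj_cons_cons (x y : X) (u v : List X) :
    Adj (x :: u) (y :: v) ↔ x = y ∧ Adj u v := by
  simp only [Adj, List.cons_append, List.cons.injEq]
  constructor
  · rintro ⟨z, ⟨h1, h2⟩ | ⟨h1, h2⟩⟩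
    · exact ⟨h1.symm, z, Or.inl h2⟩
    · exact ⟨h1, z, Or.inr h2⟩
  · rintro ⟨h, z, h2 | h2⟩
    · exact ⟨z, Or.inl ⟨h.symm, h2⟩⟩
    · exact ⟨z, Or.inr ⟨h, h2⟩⟩

/-- The action of `(g_x)_x σ` on words: `x w ↦ σ(x) g_x(w)`. -/
def branchFun (g : X → Equiv.Perm (List X)) (σ : Equiv.Perm X) : List X → List X
  | [] => []
  | x :: w => σ x :: g x w

/-- The automorphism `(g_x)_x σ` with restrictions `g_x` to the first level, on which it acts by
`σ`; that is, `x w ↦ σ(x) g_x(w)`. -/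
def branch (g : X → TreeAut X) (σ : Equiv.Perm X) : TreeAut X where
  val :=
    { toFun := branchFun (fun x => (g x).1) σ
      invFun := branchFun (fun y => (g (σ.symm y)).1⁻¹) σ⁻¹
      left_inv := by rintro (_ | ⟨x, w⟩) <;> simp [branchFun]
      right_inv := by rintro (_ | ⟨x, w⟩) <;> simp [branchFun] }
  property := by
    have nil_iff (x : X) (w : List X) : (g x).1 w = [] ↔ w = [] := by
      rw [← (g x).1.injective.eq_iff (a := w), (g x).2.1]
    refine ⟨rfl, ?_⟩
    rintro (_ | ⟨x, u⟩) (_ | ⟨y, v⟩)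
    · rfl
    · simp [branchFun, adj_nil_cons, nil_iff]
    · simp [branchFun, adj_cons_nil, nil_iff]
    · simp only [Equiv.coe_fn_mk, branchFun, adj_cons_cons, EmbeddingLike.apply_eq_iff_eq]
      constructor
      · rintro ⟨rfl, h⟩
        exact ⟨rfl, ((g x).2.2 u v).1 h⟩
      · rintro ⟨rfl, h⟩
        exact ⟨rfl, ((g x).2.2 u v).2 h⟩

/-- The automorphism `(1, …, 1) a`, which applies the permutation `a` to the first letter. -/
def rooted (a : Equiv.Perm X) : TreeAut X :=
  branch (fun _ => 1) a

end Tree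

/-! ### The mother groups -/

section Mother

/-- The action on words of `b = (b_1, …, b_{d-1}, b) σ`, where `d = n + 1`, `b_i ∈ S_d` and
`σ ∈ S_{d-1}`: a word `i w` with `i` not the last letter goes to `σ(i) b_i(w)`, and a word `d w`
goes to `d b(w)`. -/
def directedFun {n : ℕ} (b : Fin n → Equiv.Perm (Fin (n + 1))) (σ : Equiv.Perm (Fin n)) :
    List (Fin (n + 1)) → List (Fin (n + 1))
  | [] => []
  | x :: w => Fin.lastCases (motive := fun _ => List (Fin (n + 1)))
      (Fin.last n :: directedFun b σ w)
      (fun i => (σ i).castSucc :: (rooted (b i)).1 w) x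

theorem directedFun_nil {n : ℕ} (b : Fin n → Equiv.Perm (Fin (n + 1)))
    (σ : Equiv.Perm (Fin n)) : directedFun b σ [] = [] := rfl

theorem directedFun_last {n : ℕ} (b : Fin n → Equiv.Perm (Fin (n + 1)))
    (σ : Equiv.Perm (Fin n)) (w : List (Fin (n + 1))) :
    directedFun b σ (Fin.last n :: w) = Fin.last n :: directedFun b σ w := by
  rw [directedFun]; simp

theorem directedFun_castSucc {n : ℕ} (b : Fin n → Equiv.Perm (Fin (n + 1)))
    (σ : Equiv.Perm (Fin n)) (i : Fin n) (w : List (Fin (n + 1))) :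
    directedFun b σ (i.castSucc :: w) = (σ i).castSucc :: (rooted (b i)).1 w := by
  rw [directedFun]; simp

theorem rooted_inv_apply {X : Type*} (a : Equiv.Perm X) (w : List X) :
    (rooted a⁻¹).1 ((rooted a).1 w) = w := by
  cases w <;> simp [rooted, branch, branchFun]

theorem directedFun_inv {n : ℕ} (b : Fin n → Equiv.Perm (Fin (n + 1)))
    (σ : Equiv.Perm (Fin n)) (w : List (Fin (n + 1))) :
    directedFun (fun i => (b (σ⁻¹ i))⁻¹) σ⁻¹ (directedFun b σ w) = w := by
  induction w with
  | nil => rfl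
  | cons x w ih =>
    induction x using Fin.lastCases with
    | last => rw [directedFun_last, directedFun_last, ih]
    | cast i =>
      rw [directedFun_castSucc, directedFun_castSucc]
      simp [rooted_inv_apply]

theorem directedFun_inv' {n : ℕ} (b : Fin n → Equiv.Perm (Fin (n + 1)))
    (σ : Equiv.Perm (Fin n)) (w : List (Fin (n + 1))) :
    directedFun b σ (directedFun (fun i => (b (σ⁻¹ i))⁻¹) σ⁻¹ w) = w := by
  have h := directedFun_inv (fun i => (b (σ⁻¹ i))⁻¹) σ⁻¹ w
  simpa using h

theorem directedFun_eq_nil {n : ℕ} (b : Fin n → Equiv.Perm (Fin (n + 1)))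
    (σ : Equiv.Perm (Fin n)) (w : List (Fin (n + 1))) :
    directedFun b σ w = [] ↔ w = [] := by
  constructor
  · intro h
    have h2 := directedFun_inv b σ w
    rw [h] at h2
    exact h2.symm
  · rintro rfl; rfl

theorem rooted_eq_nil {X : Type*} (a : Equiv.Perm X) (w : List X) :
    (rooted a).1 w = [] ↔ w = [] := by
  cases w <;> simp [rooted, branch, branchFun]

theorem directedFun_adj {n : ℕ} (b : Fin n → Equiv.Perm (Fin (n + 1)))
    (σ : Equiv.Perm (Fin n)) (u v : List (Fin (n + 1))) :
    Adj (directedFun b σ u) (directedFun b σ v) ↔ Adj u v := by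
  induction u generalizing v with
  | nil =>
    cases v with
    | nil => rfl
    | cons y v =>
      induction y using Fin.lastCases with
      | last => simp [directedFun_nil, directedFun_last, adj_nil_cons, directedFun_eq_nil]
      | cast j => simp [directedFun_nil, directedFun_castSucc, adj_nil_cons, rooted_eq_nil]
  | cons x u ih =>
    cases v with
    | nil =>
      induction x using Fin.lastCases with
      | last => simp [directedFun_nil, directedFun_last, adj_cons_nil, directedFun_eq_nil]
      | cast j => simp [directedFun_nil, directedFun_castSucc, adj_cons_nil, rooted_eq_nil]
    | cons y v =>
      induction x using Fin.lastCases with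
      | last =>
        induction y using Fin.lastCases with
        | last => simp [directedFun_last, adj_cons_cons, ih]
        | cast j =>
          simp [directedFun_last, directedFun_castSucc, adj_cons_cons, (Fin.castSucc_ne_last _).symm]
      | cast i =>
        induction y using Fin.lastCases with
        | last => simp [directedFun_last, directedFun_castSucc, adj_cons_cons, Fin.castSucc_ne_last]
        | cast j =>
          simp only [directedFun_castSucc, adj_cons_cons, Fin.castSucc_inj,
            EmbeddingLike.apply_eq_iff_eq]
          constructor
          · rintro ⟨rfl, h⟩
            exact ⟨rfl, ((rooted (b i)).2.2 u v).1 h⟩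
          · rintro ⟨rfl, h⟩
            exact ⟨rfl, ((rooted (b i)).2.2 u v).2 h⟩

/-- The automorphism of the `d`-regular tree, `d = n + 1`, that is attached to the element
`b = (b_1, …, b_{d-1}) σ` of `B_d = S_d ≀ (d-1)` by the recursion
`b ↦ (b_1, …, b_{d-1}, b) σ`. -/
def directed {n : ℕ} (b : Fin n → Equiv.Perm (Fin (n + 1))) (σ : Equiv.Perm (Fin n)) :
    TreeAut (Fin (n + 1)) where
  val :=
    { toFun := directedFun b σ
      invFun := directedFun (fun i => (b (σ⁻¹ i))⁻¹) σ⁻¹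
      left_inv := directedFun_inv b σ
      right_inv := directedFun_inv' b σ }
  property := ⟨rfl, directedFun_adj b σ⟩

/-- The mother group `G_d`, `d = n + 1`: the image in the automorphism group of the `d`-regular
rooted tree of the free product of `S_d` and `B_d`, i.e. the subgroup generated by the images
of `S_d` and `B_d`. -/
def motherGroup (n : ℕ) : Subgroup (TreeAut (Fin (n + 1))) :=
  Subgroup.closure
    (Set.range (rooted (X := Fin (n + 1))) ∪
      {g | ∃ (b : Fin n → Equiv.Perm (Fin (n + 1))) (σ : Equiv.Perm (Fin n)), g = directed b σ})

/-- The mother group `G_3`; the letters `1, 2, 3` are `0, 1, 2 : Fin 3`. -/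
abbrev G₃ : Subgroup (TreeAut (Fin 3)) := motherGroup 2

/-- The transposition `(2 3)` as an automorphism of the ternary tree. -/
def s₂₃ : TreeAut (Fin 3) := rooted (Equiv.swap 1 2)

/-- The element `c = (1, (2 3), c)`. -/
def c : TreeAut (Fin 3) := directed (n := 2) ![1, Equiv.swap 1 2] 1

/-- The elements `t_v`: `t_∅ = (2 3) c (2 3) c`, and `t_{xv}` acts as `t_v` on the subtree at the
first-level vertex `x` and trivially elsewhere. -/
def tElt : List (Fin 3) → TreeAut (Fin 3)
  | [] => s₂₃ * c * s₂₃ * c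
  | x :: v => branch (Pi.mulSingle x (tElt v)) 1

/-- `T_n = ⟨t_v : |v| ≤ n⟩`. -/
def TLevel (n : ℕ) : Subgroup (TreeAut (Fin 3)) :=
  Subgroup.closure {g | ∃ v : List (Fin 3), v.length ≤ n ∧ g = tElt v}

/-- `T = ⟨t_v : v ∈ {1,2,3}*⟩`. -/
def T : Subgroup (TreeAut (Fin 3)) :=
  Subgroup.closure (Set.range tElt)

end Mother

end MotherFDC

namespace MotherFDC

/-! ### Permanence of the decomposition classes -/

section Coarse

universe u

variable {M : Type u} [MetricSpace M]

/-! Upper bounds. Two `t_v` on the same level commute, and `t_w` conjugates a `t_v` on its own or a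
deeper level to some `t_{v'}` or its inverse, with `|v'| = |v|` (`tElt_conj`): below `w` the
conjugator is `t_∅`, a word in `s₂₃` and `c`, both of which permute each level up to inversion.
Hence `T_n` is built from the trivial group by adjoining one `t_v` at a time, deepest level first,
each new generator normalizing what precedes it. This takes at most `(n+1) * 3^n ≤ 4^(n+1)` cyclic
extensions, each costing at most one decomposition (`CosetsInD.sup_zpowers`). For a proper length
every ball of `T` lies in some `T_n`, so distinct cosets of that `T_n` are far apart; this single
decomposition gives `𝔇_ω` (`spaceInD_omega`).

Lower bound. The element `t_∅` has infinite order, and its copies at pairwise incomparable vertices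
generate a direct sum of infinite cyclic groups (`exists_directSum_hom`). A cover showing `asdim ≤
n` would restrict to a coloured cover of a lattice in `n + 1` directions, contradicting a Lebesgue
covering argument based on a mod 2 discrete Poincaré–Miranda theorem (`infiniteAsdim_of_injective`).

Membership in `G₃`. The element `t_∅` is a commutator, and commutators can be pushed down the tree:
if `(g, p, 1)` and `(h, 1, q)` lie in the group, their commutator is `([g, h], 1, 1)`
(`atVertex_commutator`). -/

theorem lt_setDist {U V : Set M} {r s : ℝ} (hr : 0 ≤ r) (hrs : r < s)
    (h : ∀ x ∈ U, ∀ y ∈ V, s ≤ dist x y) : ENNReal.ofReal r < setDist U V := by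
  refine lt_of_lt_of_le ((ENNReal.ofReal_lt_ofReal_iff (hr.trans_lt hrs)).2 hrs) ?_
  refine le_iInf₂ fun x hx => le_iInf₂ fun y hy => ?_
  rw [edist_dist]
  exact ENNReal.ofReal_le_ofReal (h x hx y hy)

theorem lt_dist_of_lt_setDist {U V : Set M} {r : ℝ} (h : ENNReal.ofReal r < setDist U V)
    {x y : M} (hx : x ∈ U) (hy : y ∈ V) : r < dist x y := by
  have h1 : ENNReal.ofReal r < edist x y := h.trans_le (iInf₂_le_of_le x hx (iInf₂_le y hy))
  rw [edist_dist] at h1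
  exact lt_of_not_ge fun h2 => not_le.2 h1 (ENNReal.ofReal_le_ofReal h2)

theorem RDisjoint.eq_of_dist_le {r : ℝ} {𝒰 : Set (Set M)} (h : RDisjoint r 𝒰) {U V : Set M}
    (hU : U ∈ 𝒰) (hV : V ∈ 𝒰) {x y : M} (hx : x ∈ U) (hy : y ∈ V) (hxy : dist x y ≤ r) :
    U = V := by
  by_contra hne
  exact absurd (lt_dist_of_lt_setDist (h U hU V hV hne) hx hy) (not_lt.2 hxy)

theorem familyInD_zero {𝒳 : Set (Set M)} : FamilyInD 0 𝒳 ↔ UniformlyBounded 𝒳 := by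
  rw [FamilyInD]; simp

theorem familyInD_of_pos {α : Ordinal.{u}} (hα : 0 < α) {𝒳 : Set (Set M)} :
    FamilyInD α 𝒳 ↔ ∀ r : ℝ, 0 < r → ∃ β < α, ∃ 𝒴 : Set (Set M),
      FamilyInD β 𝒴 ∧ Decomposable r 𝒳 𝒴 := by
  rw [FamilyInD]; simp [hα, hα.ne']

theorem rDisjoint_singleton (r : ℝ) (A : Set M) : RDisjoint r {A} := by
  rintro U rfl V rfl h
  exact absurd rfl h

theorem Decomposable.refl (r : ℝ) (𝒳 : Set (Set M)) : Decomposable r 𝒳 𝒳 := fun A hA =>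
  ⟨A, A, (Set.union_self A).symm,
    ⟨{A}, by simpa, rDisjoint_singleton r A, by simp⟩,
    ⟨{A}, by simpa, rDisjoint_singleton r A, by simp⟩⟩

theorem FamilyInD.mono {α β : Ordinal.{u}} (h : α ≤ β) {𝒳 : Set (Set M)} (hX : FamilyInD α 𝒳) :
    FamilyInD β 𝒳 := by
  rcases eq_or_ne β 0 with rfl | hβ
  · rwa [le_antisymm h (zero_le (a := α))] at hX
  have hβ := pos_iff_ne_zero.2 hβ
  rw [familyInD_of_pos hβ]
  intro r hr
  rcases h.eq_or_lt with rfl | h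
  · exact (familyInD_of_pos hβ).1 hX r hr
  · exact ⟨α, h, 𝒳, hX, Decomposable.refl r 𝒳⟩

/-- If every member of `𝒳'` lies in the `B`-neighbourhood of a member of `𝒳`, then `𝒳'` belongs to
every class to which `𝒳` belongs. -/
theorem FamilyInD.of_neighbourhoods (B : ℝ) (α : Ordinal.{u}) :
    ∀ {𝒳 𝒳' : Set (Set M)}, FamilyInD α 𝒳 →
      (∀ A' ∈ 𝒳', ∃ A ∈ 𝒳, ∀ x ∈ A', ∃ y ∈ A, dist x y ≤ B) → FamilyInD α 𝒳' := by
  induction α using WellFoundedLT.induction with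
  | ind α ih =>
  intro 𝒳 𝒳' hX hn
  rcases eq_or_ne α 0 with rfl | hα
  · rw [familyInD_zero] at hX ⊢
    obtain ⟨D, hD⟩ := hX
    refine ⟨B + D + B, fun A' hA' x hx y hy => ?_⟩
    obtain ⟨A, hA, h⟩ := hn A' hA'
    obtain ⟨x', hx', hxx⟩ := h x hx
    obtain ⟨y', hy', hyy⟩ := h y hy
    have := hD A hA x' hx' y' hy'
    have := dist_triangle4 x x' y' y
    rw [dist_comm y] at hyy
    linarith
  have hα := pos_iff_ne_zero.2 hα
  rw [familyInD_of_pos hα] at hX ⊢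
  intro r hr
  -- Thickening both pieces by `B` costs `2 * |B|`. The extra `1` leaves a uniform gap, since
  -- `RDisjoint` asks for an infimum strictly above `r`.
  obtain ⟨β, hβ, 𝒴, hY, hdec⟩ := hX (r + 1 + 2 * |B|) (by positivity)
  refine ⟨β, hβ, {Z | ∃ Y ∈ 𝒴, ∀ x ∈ Z, ∃ y ∈ Y, dist x y ≤ B}, ih β hβ hY fun Z hZ => hZ, ?_⟩
  intro A' hA'
  obtain ⟨A, hA, h⟩ := hn A' hA'
  obtain ⟨A₀, A₁, hAA, h₀, h₁⟩ := hdec A hA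
  have key : ∀ A₀ : Set M, (∃ 𝒰 ⊆ 𝒴, RDisjoint (r + 1 + 2 * |B|) 𝒰 ∧ A₀ = ⋃₀ 𝒰) →
      ∃ 𝒰 ⊆ {Z | ∃ Y ∈ 𝒴, ∀ x ∈ Z, ∃ y ∈ Y, dist x y ≤ B}, RDisjoint r 𝒰 ∧
        {x ∈ A' | ∃ y ∈ A₀, dist x y ≤ B} = ⋃₀ 𝒰 := by
    rintro A₀ ⟨𝒰, hU, hd, rfl⟩
    refine ⟨(fun U => {x ∈ A' | ∃ y ∈ U, dist x y ≤ B}) '' 𝒰, ?_, ?_, ?_⟩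
    · rintro _ ⟨U, hUU, rfl⟩
      exact ⟨U, hU hUU, fun x hx => hx.2⟩
    · rintro _ ⟨U, hUU, rfl⟩ _ ⟨V, hVV, rfl⟩ hne
      refine lt_setDist hr.le (lt_add_one r) ?_
      rintro x ⟨-, x', hx', hxx⟩ y ⟨-, y', hy', hyy⟩
      have h1 := lt_dist_of_lt_setDist (hd U hUU V hVV (fun e => hne (by rw [e]))) hx' hy'
      have := dist_triangle4 x' x y y'
      rw [dist_comm x' x] at this
      have := le_abs_self B
      linarith
    · ext x
      simp only [Set.mem_sUnion, Set.mem_ofPred_eq, Set.mem_image, exists_exists_and_eq_and]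
      constructor
      · rintro ⟨hx, y, ⟨U, hUU, hy⟩, hxy⟩
        exact ⟨U, hUU, hx, y, hy, hxy⟩
      · rintro ⟨U, hUU, hx, y, hy, hxy⟩
        exact ⟨hx, y, ⟨U, hUU, hy⟩, hxy⟩
  refine ⟨_, _, ?_, key A₀ h₀, key A₁ h₁⟩
  ext x
  simp only [Set.mem_union, Set.mem_ofPred_eq]
  constructor
  · intro hx
    obtain ⟨y, hy, hxy⟩ := h x hx
    rw [hAA] at hy
    rcases hy with hy | hy
    · exact Or.inl ⟨hx, y, hy, hxy⟩
    · exact Or.inr ⟨hx, y, hy, hxy⟩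
  · rintro (h | h) <;> exact h.1

end Coarse

/-! ### A discrete Poincaré–Miranda theorem -/

section PoincareMiranda

open Finsupp

variable {ι : Type*} [DecidableEq ι] (u : ι → (ι →₀ ℕ) → ZMod 2)

/-- The discrete Jacobian of the functions `u j`, `j` in a list, in the directions in `S`, that is
the cup product of their coboundaries on the standard triangulation of the unit cube. -/
noncomputable def jacobian : List ι → Finset ι → (ι →₀ ℕ) → ZMod 2
  | [], _, _ => 1
  | j :: L, S, x => ∑ i ∈ S, (u j (x + single i 1) - u j x) *
      jacobian L (S.erase i) (x + single i 1)

/-- The Jacobian is closed. -/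
theorem sum_diff_jacobian (L : List ι) (S : Finset ι) (x : ι →₀ ℕ) :
    ∑ i ∈ S, (jacobian u L (S.erase i) (x + single i 1) - jacobian u L (S.erase i) x) = 0 := by
  induction L generalizing S x with
  | nil => simp [jacobian]
  | cons j L ih =>
    have expand (i : ι) : jacobian u (j :: L) (S.erase i) (x + single i 1)
          - jacobian u (j :: L) (S.erase i) x =
        ∑ k ∈ S.erase i, ((u j (x + single i 1 + single k 1) - u j (x + single i 1)
            - u j (x + single k 1) + u j x) *
            jacobian u L ((S.erase i).erase k) (x + single i 1 + single k 1) +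
          (u j (x + single k 1) - u j x) *
            (jacobian u L ((S.erase k).erase i) (x + single k 1 + single i 1) -
              jacobian u L ((S.erase k).erase i) (x + single k 1))) := by
      rw [jacobian, jacobian, ← Finset.sum_sub_distrib]
      refine Finset.sum_congr rfl fun k _ => ?_
      rw [Finset.erase_right_comm, add_right_comm x (single k 1)]
      ring
    simp_rw [expand, Finset.sum_add_distrib]
    have swap_sum (f : ι → ι → ZMod 2) :
        ∑ i ∈ S, ∑ k ∈ S.erase i, f i k = ∑ k ∈ S, ∑ i ∈ S.erase k, f i k :=
      Finset.sum_comm' fun i k => by simp only [Finset.mem_erase, ne_eq]; tauto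
    have h2 : ∑ i ∈ S, ∑ k ∈ S.erase i, (u j (x + single k 1) - u j x) *
            (jacobian u L ((S.erase k).erase i) (x + single k 1 + single i 1) -
              jacobian u L ((S.erase k).erase i) (x + single k 1)) = 0 := by
      rw [swap_sum]
      refine Finset.sum_eq_zero fun k _ => ?_
      rw [← Finset.mul_sum, ih, mul_zero]
    rw [h2, add_zero]
    rw [← Finset.sum_sigma (s := S) (t := fun i => S.erase i) (f := fun p : (_ : ι) × ι =>
      (u j (x + single p.1 1 + single p.2 1) - u j (x + single p.1 1)
            - u j (x + single p.2 1) + u j x) *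
            jacobian u L ((S.erase p.1).erase p.2) (x + single p.1 1 + single p.2 1))]
    -- The remaining terms are symmetric in the two directions, so they cancel in pairs modulo 2.
    refine Finset.sum_involution (fun p _ => ⟨p.2, p.1⟩) ?_ ?_ ?_ ?_
    · rintro ⟨i, k⟩ _
      simp only
      rw [Finset.erase_right_comm, add_right_comm x (single k 1)]
      rw [sub_right_comm]
      exact CharTwo.add_self_eq_zero _
    · rintro ⟨i, k⟩ h _ e
      simp only [Sigma.mk.injEq, heq_eq_eq] at e
      simp only [Finset.mem_sigma, Finset.mem_erase] at h
      exact h.2.1 e.1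
    · rintro ⟨i, k⟩ h
      simp only [Finset.mem_sigma, Finset.mem_erase] at h ⊢
      exact ⟨h.2.2, h.2.1.symm, h.1⟩
    · rintro ⟨i, k⟩ _
      rfl

/-- The Jacobian is exact. -/
theorem jacobian_cons (j : ι) (L : List ι) (S : Finset ι) (x : ι →₀ ℕ) :
    jacobian u (j :: L) S x = ∑ i ∈ S,
      (u j (x + single i 1) * jacobian u L (S.erase i) (x + single i 1) -
        u j x * jacobian u L (S.erase i) x) := by
  have h : u j x * ∑ i ∈ S,
      (jacobian u L (S.erase i) (x + single i 1) - jacobian u L (S.erase i) x) = 0 := by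
    rw [sum_diff_jacobian, mul_zero]
  rw [jacobian, ← add_zero (∑ i ∈ S, _), ← h, Finset.mul_sum, ← Finset.sum_add_distrib]
  refine Finset.sum_congr rfl fun i _ => ?_
  ring

/-- The Jacobian vanishes on a face on which one of the functions is constant. -/
theorem jacobian_eq_zero {i : ι} {m : ℕ} {a : ZMod 2} (hi : ∀ x : ι →₀ ℕ, x i = m → u i x = a)
    {L : List ι} (hL : i ∈ L) {S : Finset ι} (hS : i ∉ S) {x : ι →₀ ℕ} (hx : x i = m) :
    jacobian u L S x = 0 := by
  induction L generalizing S x with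
  | nil => simp at hL
  | cons j L ih =>
    rw [jacobian]
    refine Finset.sum_eq_zero fun k hk => ?_
    have hne : i ≠ k := fun e => hS (by rwa [e])
    have hx' : (x + single k 1 : ι →₀ ℕ) i = m := by
      rw [Finsupp.add_apply, hx, single_eq_of_ne hne, add_zero]
    rcases List.mem_cons.1 hL with rfl | hL
    · rw [hi _ hx, hi _ hx', sub_self, zero_mul]
    · rw [ih hL (fun h => hS (Finset.mem_of_mem_erase h)) hx', mul_zero]

/-- The lattice points of the half-open cube of side `k` in the directions in `S`. -/
noncomputable def box (S : Finset ι) (k : ℕ) : Finset (ι →₀ ℕ) :=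
  S.finsupp fun _ => Finset.range k

/-- Telescoping along the lines in direction `i`: the discrete divergence theorem for one direction.
-/
theorem sum_box_diff {S : Finset ι} {i : ι} (hi : i ∈ S) (k : ℕ) (g : (ι →₀ ℕ) → ZMod 2) :
    ∑ x ∈ box S k, (g (x + single i 1) - g x) =
      ∑ x ∈ box (S.erase i) k, (g (x + single i k) - g x) := by
  have h : ∀ x : ι →₀ ℕ, g (x + single i k) - g x =
      ∑ m ∈ Finset.range k, (g (x + single i m + single i 1) - g (x + single i m)) := by
    intro x
    have := Finset.sum_range_sub (fun m => g (x + single i m)) k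
    simp only [single_zero, add_zero] at this
    rw [← this]
    simp_rw [add_assoc, ← single_add]
  simp_rw [h]
  rw [← Finset.sum_product']
  refine Finset.sum_nbij' (fun x => (x.erase i, x i)) (fun p => p.1 + single i p.2) ?_ ?_ ?_ ?_ ?_
  · intro x hx
    simp only [box, Finset.mem_finsupp_iff, Finset.mem_product] at hx ⊢
    refine ⟨⟨?_, fun l hl => ?_⟩, hx.2 i hi⟩
    · rw [Finsupp.support_erase]
      exact Finset.erase_subset_erase i hx.1
    · rw [Finset.mem_erase] at hl
      rw [Finsupp.erase_ne hl.1]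
      exact hx.2 l hl.2
  · rintro ⟨x, m⟩ hx
    simp only [box, Finset.mem_finsupp_iff, Finset.mem_product] at hx ⊢
    obtain ⟨⟨h1, h2⟩, h3⟩ := hx
    have hxi : x i = 0 := by
      by_contra hne
      exact Finset.notMem_erase i S (h1 (Finsupp.mem_support_iff.2 hne))
    refine ⟨fun l hl => ?_, fun l hl => ?_⟩
    · rcases eq_or_ne l i with rfl | hne
      · exact hi
      · refine Finset.mem_of_mem_erase (h1 (Finsupp.mem_support_iff.2 ?_))
        rwa [Finsupp.mem_support_iff, Finsupp.add_apply, single_eq_of_ne hne, add_zero] at hl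
    · rcases eq_or_ne l i with rfl | hne
      · simpa [hxi] using h3
      · rw [Finsupp.add_apply, single_eq_of_ne hne, add_zero]
        exact h2 l (Finset.mem_erase.2 ⟨hne, hl⟩)
  · intro x _
    exact Finsupp.erase_add_single i x
  · rintro ⟨x, m⟩ hx
    simp only [box, Finset.mem_finsupp_iff, Finset.mem_product] at hx
    have hxi : x i = 0 := by
      by_contra hne
      exact Finset.notMem_erase i S (hx.1.1 (Finsupp.mem_support_iff.2 hne))
    simp [hxi, Finsupp.erase_add]
  · intro x _
    simp only [Finsupp.erase_add_single]

/-- A degree computation by Stokes. The exact form of the Jacobian telescopes to the faces of the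
box. In a direction `i ≠ j` the function `u i` is constant on both faces, which kills the remaining
Jacobian; in direction `j` only the face `x j = 0` survives, where the sum is the same one for `L`.
-/
theorem sum_box_jacobian {k : ℕ} (L : List ι) (hL : L.Nodup)
    (h0 : ∀ j ∈ L, ∀ x : ι →₀ ℕ, x j = 0 → u j x = 1)
    (hk : ∀ j ∈ L, ∀ x : ι →₀ ℕ, x j = k → u j x = 0) :
    ∑ x ∈ box L.toFinset k, jacobian u L L.toFinset x = 1 := by
  induction L with
  | nil => simp [box, jacobian]
  | cons j L ih =>
    rw [List.nodup_cons] at hL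
    have ih := ih hL.2 (fun i hi => h0 i (List.mem_cons_of_mem j hi))
      (fun i hi => hk i (List.mem_cons_of_mem j hi))
    simp_rw [jacobian_cons]
    rw [Finset.sum_comm]
    have hj : j ∈ (j :: L).toFinset := by simp
    have hz : ∀ (S : Finset ι) (i : ι), i ∉ S → ∀ x ∈ box S k, x i = 0 := by
      intro S i hi x hx
      by_contra hne
      exact hi ((Finset.mem_finsupp_iff.1 hx).1 (Finsupp.mem_support_iff.2 hne))
    rw [Finset.sum_eq_single_of_mem j hj]
    · rw [sum_box_diff hj k (fun x => u j x * jacobian u L ((j :: L).toFinset.erase j) x)]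
      have he : (j :: L).toFinset.erase j = L.toFinset := by
        rw [List.toFinset_cons, Finset.erase_insert (by simpa using hL.1)]
      -- The face term is `0 * J - 1 * J = -J`, whence the sign is inserted on the other side.
      rw [he, ← ZMod.neg_eq_self_mod_two (1 : ZMod 2), ← ih, ← Finset.sum_neg_distrib]
      refine Finset.sum_congr rfl fun x hx => ?_
      have hxj := hz L.toFinset j (by simpa using hL.1) x hx
      rw [h0 j (by simp) x hxj, hk j (by simp) (x + single j k) (by simp [hxj])]
      ring
    · intro i hi hne
      have hiL : i ∈ L := by simpa [hne] using hi
      rw [sum_box_diff hi k (fun x => u j x * jacobian u L ((j :: L).toFinset.erase i) x)]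
      refine Finset.sum_eq_zero fun x hx => ?_
      have hxi := hz _ i (Finset.notMem_erase i _) x hx
      rw [jacobian_eq_zero u (h0 i (List.mem_cons_of_mem j hiL)) hiL (Finset.notMem_erase i _) hxi,
        jacobian_eq_zero u (hk i (List.mem_cons_of_mem j hiL)) hiL (Finset.notMem_erase i _)
          (by simp [hxi])]
      ring

/-- The Jacobian sums over monotone edge paths in the unit cube at `x`; a nonzero term is a path on
which every `u j` changes at some step. -/
theorem exists_ne_of_jacobian_ne_zero {L : List ι} {S : Finset ι} {x : ι →₀ ℕ}
    (h : jacobian u L S x ≠ 0) {j : ι} (hj : j ∈ L) :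
    ∃ A ⊆ S, ∃ B ⊆ S, u j (x + ∑ i ∈ A, single i 1) ≠ u j (x + ∑ i ∈ B, single i 1) := by
  induction L generalizing S x with
  | nil => simp at hj
  | cons k L ih =>
    rw [jacobian] at h
    obtain ⟨i, hi, hne⟩ := Finset.exists_ne_zero_of_sum_ne_zero h
    rcases List.mem_cons.1 hj with rfl | hj
    · refine ⟨{i}, by simpa, ∅, by simp, fun e => hne ?_⟩
      simp only [Finset.sum_singleton, Finset.sum_empty, add_zero] at e
      rw [e, sub_self, zero_mul]
    · obtain ⟨A, hA, B, hB, hAB⟩ := ih (right_ne_zero_of_mul hne) hj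
      have key : ∀ A ⊆ S.erase i, x + single i 1 + ∑ l ∈ A, single l 1 =
          x + ∑ l ∈ insert i A, single l 1 := by
        intro A hA
        rw [Finset.sum_insert (fun h => Finset.notMem_erase i S (hA h)), add_assoc]
      have hsub : ∀ A ⊆ S.erase i, insert i A ⊆ S := fun A hA =>
        Finset.insert_subset hi (hA.trans (Finset.erase_subset i S))
      rw [key A hA, key B hB] at hAB
      exact ⟨_, hsub A hA, _, hsub B hB, hAB⟩

/-- The discrete Poincaré–Miranda theorem: if the set `W j` contains the face `x j = 0` and misses
the face `x j = k`, for each of finitely many `j`, then there is a unit cube that meets every `W j`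
and every complement of `W j`. -/
theorem exists_cube_meeting_boundaries (S : Finset ι) (W : ι → Set (ι →₀ ℕ)) (k : ℕ)
    (h0 : ∀ j ∈ S, ∀ x : ι →₀ ℕ, x j = 0 → x ∈ W j)
    (hk : ∀ j ∈ S, ∀ x : ι →₀ ℕ, x j = k → x ∉ W j) :
    ∃ x : ι →₀ ℕ, ∀ j ∈ S, ∃ A ⊆ S, ∃ B ⊆ S,
      x + ∑ i ∈ A, single i 1 ∈ W j ∧ x + ∑ i ∈ B, single i 1 ∉ W j := by
  classical
  set u : ι → (ι →₀ ℕ) → ZMod 2 := fun j x => if x ∈ W j then 1 else 0 with hu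
  have h := sum_box_jacobian u (k := k) S.toList S.nodup_toList
    (fun j hj x hx => if_pos (h0 j (by simpa using hj) x hx))
    (fun j hj x hx => if_neg (hk j (by simpa using hj) x hx))
  rw [Finset.toList_toFinset] at h
  obtain ⟨x, -, hx⟩ := Finset.exists_ne_zero_of_sum_ne_zero (by rw [h]; exact one_ne_zero)
  refine ⟨x, fun j hj => ?_⟩
  obtain ⟨A, hA, B, hB, hAB⟩ := exists_ne_of_jacobian_ne_zero u hx (j := j) (by simpa using hj)
  simp only [hu] at hAB
  by_cases h1 : x + ∑ i ∈ A, single i 1 ∈ W j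
  · by_cases h2 : x + ∑ i ∈ B, single i 1 ∈ W j
    · simp [h1, h2] at hAB
    · exact ⟨A, hA, B, hB, h1, h2⟩
  · by_cases h2 : x + ∑ i ∈ B, single i 1 ∈ W j
    · exact ⟨B, hB, A, hA, h2, h1⟩
    · simp [h1, h2] at hAB

end PoincareMiranda

/-! ### Calculus in the automorphism group of the tree -/

section TreeCalculus

variable {X : Type*}

@[simp]
theorem TreeAut.apply_nil (g : TreeAut X) : g.1 [] = [] := g.2.1

@[simp]
theorem branch_apply_cons (g : X → TreeAut X) (σ : Equiv.Perm X) (x : X) (w : List X) :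
    (branch g σ).1 (x :: w) = σ x :: (g x).1 w := rfl

theorem TreeAut.ext_cons {g h : TreeAut X} (H : ∀ x w, g.1 (x :: w) = h.1 (x :: w)) : g = h := by
  refine Subtype.ext (Equiv.ext fun w => ?_)
  cases w with
  | nil => simp
  | cons x w => exact H x w

theorem branch_mul (g h : X → TreeAut X) (σ τ : Equiv.Perm X) :
    branch g σ * branch h τ = branch (fun x => g (τ x) * h x) (σ * τ) :=
  TreeAut.ext_cons fun _ _ => rfl

theorem branch_one : branch (1 : X → TreeAut X) 1 = 1 := TreeAut.ext_cons fun _ _ => rfl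

/-- The embedding of `X`-tuples of automorphisms as the stabilizer of the first level. -/
def branchHom : (X → TreeAut X) →* TreeAut X where
  toFun g := branch g 1
  map_one' := branch_one
  map_mul' g h := by rw [branch_mul]; rfl

theorem branchHom_apply (g : X → TreeAut X) : branchHom g = branch g 1 := rfl

@[simp]
theorem branchHom_apply_cons (g : X → TreeAut X) (x : X) (w : List X) :
    (branchHom g).1 (x :: w) = x :: (g x).1 w := rfl

theorem branchHom_injective : Function.Injective (branchHom (X := X)) := by
  intro g h e
  funext x
  refine Subtype.ext (Equiv.ext fun w => ?_)
  have := congrArg (fun k : TreeAut X => k.1 (x :: w)) e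
  simpa using this

theorem rooted_mul (a b : Equiv.Perm X) : rooted (a * b) = rooted a * rooted b := by
  rw [rooted, rooted, rooted, branch_mul]; simp

theorem rooted_one : rooted (1 : Equiv.Perm X) = 1 := branch_one

theorem rooted_mul_branchHom (a : Equiv.Perm X) (g : X → TreeAut X) :
    rooted a * branchHom g * (rooted a)⁻¹ = branchHom (g ∘ a.symm) := by
  rw [mul_inv_eq_iff_eq_mul, branchHom_apply, branchHom_apply, rooted, branch_mul, branch_mul]
  simp

variable [DecidableEq X]

/-- The embedding of the automorphism group as the group acting on the subtree at `x`. -/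
def atVertex (x : X) : TreeAut X →* TreeAut X := branchHom.comp (MonoidHom.mulSingle (fun _ : X => TreeAut X) x)

theorem atVertex_apply (x : X) (g : TreeAut X) : atVertex x g = branchHom (Pi.mulSingle x g) := rfl

theorem atVertex_apply_same (x : X) (g : TreeAut X) (w : List X) :
    (atVertex x g).1 (x :: w) = x :: g.1 w := by
  simp [atVertex_apply]

theorem atVertex_apply_ne {x y : X} (h : y ≠ x) (g : TreeAut X) (w : List X) :
    (atVertex x g).1 (y :: w) = y :: w := by
  simp [atVertex_apply, h]

theorem atVertex_commute {x y : X} (h : x ≠ y) (g k : TreeAut X) :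
    Commute (atVertex x g) (atVertex y k) :=
  (show Commute (Pi.mulSingle x g : X → TreeAut X) (Pi.mulSingle y k) from
    Pi.mulSingle_commute (f := fun _ : X => TreeAut X) h g k).map branchHom

theorem rooted_conj_atVertex (a : Equiv.Perm X) (x : X) (g : TreeAut X) :
    rooted a * atVertex x g * (rooted a)⁻¹ = atVertex (a x) g := by
  rw [atVertex_apply, rooted_mul_branchHom, atVertex_apply]
  congr 1
  funext y
  simp only [Function.comp_apply, Pi.mulSingle_apply, Equiv.symm_apply_eq]

theorem branchHom_conj_atVertex (p : X → TreeAut X) (x : X) (g : TreeAut X) :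
    branchHom p * atVertex x g * (branchHom p)⁻¹ = atVertex x (p x * g * (p x)⁻¹) := by
  rw [atVertex_apply, atVertex_apply, ← map_inv, ← map_mul, ← map_mul]
  congr 1
  funext y
  rcases eq_or_ne y x with rfl | h
  · simp
  · simp [h]

end TreeCalculus

/-! ### The elements `t_v` -/

section Elements

theorem directed_one_eq (b : Fin 2 → Equiv.Perm (Fin 3)) :
    directed b 1 = branchHom ![rooted (b 0), rooted (b 1), directed b 1] := by
  refine TreeAut.ext_cons fun x w => ?_
  change directedFun b 1 (x :: w) = _
  fin_cases x
  · exact directedFun_castSucc b 1 0 w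
  · exact directedFun_castSucc b 1 1 w
  · exact directedFun_last b 1 w

theorem c_eq : c = branchHom ![1, s₂₃, c] := by
  have := directed_one_eq ![1, Equiv.swap 1 2]
  rw [c]
  conv_lhs => rw [this]
  simp [rooted_one, s₂₃]

theorem s_mul_s : s₂₃ * s₂₃ = 1 := by
  rw [s₂₃, ← rooted_mul, Equiv.swap_mul_self, rooted_one]

theorem c_mul_c : c * c = 1 := by
  refine Subtype.ext (Equiv.ext fun w => ?_)
  induction w with
  | nil => simp
  | cons x w ih =>
    have h : c * c = branchHom ![1, 1, c * c] := by
      conv_lhs => rw [c_eq, ← map_mul]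
      congr 1
      funext i
      fin_cases i <;> simp [s_mul_s]
    rw [h]
    fin_cases x
    · rfl
    · rfl
    · rw [branchHom_apply_cons]
      change _ :: (c * c).1 w = _
      rw [ih]; rfl

theorem s_inv : s₂₃⁻¹ = s₂₃ := inv_eq_of_mul_eq_one_right s_mul_s

theorem c_inv : c⁻¹ = c := inv_eq_of_mul_eq_one_right c_mul_c

theorem tElt_nil : tElt [] = (s₂₃ * c) ^ 2 := by rw [pow_two, ← mul_assoc]; rfl

theorem tElt_cons (x : Fin 3) (v : List (Fin 3)) : tElt (x :: v) = atVertex x (tElt v) := rfl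

theorem s_conj_branchHom (g : Fin 3 → TreeAut (Fin 3)) :
    s₂₃ * branchHom g * s₂₃ = branchHom ![g 0, g 2, g 1] := by
  have := rooted_mul_branchHom (Equiv.swap 1 2) g
  rw [← s₂₃, s_inv] at this
  rw [this]
  congr 1
  funext i
  fin_cases i
  · rfl
  · rfl
  · rfl

/-- Self-similarity of `t_∅ = (s₂₃ c)²`: its restrictions are powers of `s₂₃ c`. This drives the
proof that `t_∅` has infinite order. -/
theorem tElt_nil_eq : tElt [] = branchHom ![1, (s₂₃ * c)⁻¹, s₂₃ * c] := by
  have h : tElt [] = (s₂₃ * c * s₂₃) * c := rfl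
  have h2 : s₂₃ * c * s₂₃ = branchHom ![1, c, s₂₃] := by
    rw [c_eq, s_conj_branchHom, ← c_eq]; rfl
  rw [h, h2]
  conv_lhs => rw [c_eq, ← c_eq]
  conv_lhs => arg 2; rw [c_eq]
  rw [← map_mul]
  congr 1
  funext i
  fin_cases i
  · simp
  · simp [c_inv, s_inv]
  · simp

/-- `h` conjugates every `t_v` into some `t_{v'}` or its inverse, with `v'` as long as `v`. -/
def PermutesLevels (h : TreeAut (Fin 3)) : Prop :=
  ∀ v, ∃ v' : List (Fin 3), v'.length = v.length ∧
    (h * tElt v * h⁻¹ = tElt v' ∨ h * tElt v * h⁻¹ = (tElt v')⁻¹)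

theorem PermutesLevels.mul {g h : TreeAut (Fin 3)} (hg : PermutesLevels g)
    (hh : PermutesLevels h) : PermutesLevels (g * h) := by
  intro v
  have key (w : TreeAut (Fin 3)) : g * h * w * (g * h)⁻¹ = g * (h * w * h⁻¹) * g⁻¹ := by group
  have kinv (w : TreeAut (Fin 3)) : g * w⁻¹ * g⁻¹ = (g * w * g⁻¹)⁻¹ := by group
  obtain ⟨v', hl, h1⟩ := hh v
  obtain ⟨v'', hl', h2⟩ := hg v'
  refine ⟨v'', hl'.trans hl, ?_⟩
  rw [key]
  rcases h1 with h1 | h1 <;> rcases h2 with h2 | h2 <;> rw [h1]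
  · exact Or.inl h2
  · exact Or.inr h2
  · rw [kinv, h2]; exact Or.inr rfl
  · rw [kinv, h2]; exact Or.inl (inv_inv _)

theorem permutesLevels_s : PermutesLevels s₂₃ := by
  rintro (_ | ⟨x, v⟩)
  · refine ⟨[], rfl, Or.inr ?_⟩
    rw [tElt_nil, s_inv, pow_two]
    simp only [mul_inv_rev, s_inv, c_inv, mul_assoc]
    rw [← mul_assoc s₂₃ s₂₃, s_mul_s, one_mul]
  · refine ⟨Equiv.swap 1 2 x :: v, rfl, Or.inl ?_⟩
    rw [tElt_cons, s₂₃, rooted_conj_atVertex, tElt_cons]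

/-- Since `c = (1, s₂₃, c)`, conjugation at a first-level vertex is by `1`, `s₂₃` or again `c`, so
induction on `v` applies. -/
theorem permutesLevels_c : PermutesLevels c := by
  intro v
  induction v with
  | nil =>
    refine ⟨[], rfl, Or.inr ?_⟩
    rw [tElt_nil, c_inv, pow_two]
    simp only [mul_inv_rev, s_inv, c_inv, mul_assoc, c_mul_c, mul_one]
  | cons x v ih =>
    have key (y : Fin 3) (g h : TreeAut (Fin 3)) (v v' : List (Fin 3)) (hl : v'.length = v.length)
        (hc : c * atVertex y (tElt v) * c⁻¹ = atVertex y (h * tElt v * h⁻¹))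
        (hv : h * tElt v * h⁻¹ = tElt v' ∨ h * tElt v * h⁻¹ = (tElt v')⁻¹) :
        ∃ w : List (Fin 3), w.length = (y :: v).length ∧
          (c * tElt (y :: v) * c⁻¹ = tElt w ∨ c * tElt (y :: v) * c⁻¹ = (tElt w)⁻¹) := by
      refine ⟨y :: v', by simp [hl], ?_⟩
      rw [tElt_cons, tElt_cons, hc]
      rcases hv with hv | hv
      · exact Or.inl (by rw [hv])
      · exact Or.inr (by rw [hv, map_inv])
    have hc (y : Fin 3) (g : TreeAut (Fin 3)) :
        c * atVertex y g * c⁻¹ = atVertex y (![1, s₂₃, c] y * g * (![1, s₂₃, c] y)⁻¹) := by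
      have := branchHom_conj_atVertex ![1, s₂₃, c] y g
      rwa [← c_eq] at this
    fin_cases x
    · exact key 0 1 1 v v rfl (hc 0 _) (Or.inl (by simp))
    · obtain ⟨v', hl, hv⟩ := permutesLevels_s v
      exact key 1 1 s₂₃ v v' hl (hc 1 _) hv
    · obtain ⟨v', hl, hv⟩ := ih
      exact key 2 1 c v v' hl (hc 2 _) hv

/-- Strip the common prefix. Either the words diverge and the elements commute, or `w` is used up
first, by the length hypothesis, and the conjugator is `t_∅`. -/
theorem tElt_conj (w v : List (Fin 3)) (h : w.length ≤ v.length) :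
    (∃ v' : List (Fin 3), v'.length = v.length ∧
      (tElt w * tElt v * (tElt w)⁻¹ = tElt v' ∨ tElt w * tElt v * (tElt w)⁻¹ = (tElt v')⁻¹)) ∧
    ∃ v' : List (Fin 3), v'.length = v.length ∧
      ((tElt w)⁻¹ * tElt v * tElt w = tElt v' ∨ (tElt w)⁻¹ * tElt v * tElt w = (tElt v')⁻¹) := by
  induction w generalizing v with
  | nil =>
    have h1 := ((permutesLevels_s.mul permutesLevels_c).mul permutesLevels_s).mul permutesLevels_c
    have h2 := ((permutesLevels_c.mul permutesLevels_s).mul permutesLevels_c).mul permutesLevels_s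
    have hi : (tElt [])⁻¹ = c * s₂₃ * c * s₂₃ := by
      rw [tElt]; simp only [mul_inv_rev, s_inv, c_inv, mul_assoc]
    rw [← hi] at h2
    refine ⟨h1 v, ?_⟩
    have := h2 v
    rwa [inv_inv] at this
  | cons x w ih =>
    cases v with
    | nil => simp at h
    | cons y v =>
      rcases eq_or_ne x y with rfl | hne
      · simp only [tElt_cons, ← map_mul, ← map_inv]
        obtain ⟨⟨v₁, hl₁, h₁⟩, v₂, hl₂, h₂⟩ := ih v (by simpa using h)
        refine ⟨⟨x :: v₁, by simp [hl₁], ?_⟩, ⟨x :: v₂, by simp [hl₂], ?_⟩⟩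
        · rcases h₁ with h₁ | h₁
          · exact Or.inl (by rw [h₁]; rfl)
          · exact Or.inr (by rw [h₁, map_inv]; rfl)
        · rcases h₂ with h₂ | h₂
          · exact Or.inl (by rw [h₂]; rfl)
          · exact Or.inr (by rw [h₂, map_inv]; rfl)
      · have hc := atVertex_commute hne (tElt w) (tElt v)
        refine ⟨⟨y :: v, rfl, Or.inl ?_⟩, ⟨y :: v, rfl, Or.inl ?_⟩⟩
        · rw [tElt_cons, tElt_cons, hc.eq, mul_inv_cancel_right]
        · rw [tElt_cons, tElt_cons, mul_assoc, ← hc.eq, inv_mul_cancel_left]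

theorem tElt_commute {v w : List (Fin 3)} (h : v.length = w.length) :
    Commute (tElt v) (tElt w) := by
  induction v generalizing w with
  | nil =>
    rw [List.length_nil, eq_comm, List.length_eq_zero_iff] at h
    rw [h]
  | cons x v ih =>
    cases w with
    | nil => simp at h
    | cons y w =>
      rcases eq_or_ne x y with rfl | hne
      · exact (ih (by simpa using h)).map (atVertex x)
      · exact atVertex_commute hne _ _

theorem tElt_nil_zpow (n : ℤ) :
    tElt [] ^ n = branchHom ![1, ((s₂₃ * c) ^ n)⁻¹, (s₂₃ * c) ^ n] := by
  rw [tElt_nil_eq, ← map_zpow]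
  congr 1
  funext i
  fin_cases i <;> simp [-mul_inv_rev]

/-- If `t_∅ ^ n = 1`, its third restriction gives `(s₂₃ c) ^ n = 1`. For `n = 2m` this is `t_∅ ^ m =
1`, a descent. For odd `n` the element moves a first-level vertex, as `c` and `t_∅` fix that level
and `s₂₃` does not. -/
theorem tElt_nil_zpow_ne_one (n : ℕ) (hn : n ≠ 0) : tElt [] ^ (n : ℤ) ≠ 1 := by
  induction n using Nat.strong_induction_on with
  | _ n ih =>
    intro h
    rw [tElt_nil_zpow, ← map_one branchHom] at h
    have h1 : (s₂₃ * c) ^ (n : ℤ) = 1 := congrFun (branchHom_injective h) 2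
    obtain ⟨m, rfl | rfl⟩ := Nat.even_or_odd' n
    · refine ih m (by omega) (by omega) ?_
      rw [tElt_nil, ← h1]
      push_cast
      rw [zpow_mul]; rfl
    · have h2 : s₂₃ * c * tElt [] ^ (m : ℤ) = 1 := by
        rw [tElt_nil, ← h1]
        push_cast
        rw [zpow_add, zpow_mul, zpow_one, ((Commute.refl _).zpow_left _).zpow_left _ |>.eq]
        rfl
      have h3 := congrArg (fun k : TreeAut (Fin 3) => k.1 [1]) h2
      simp only [Subgroup.coe_mul, Equiv.Perm.mul_apply, tElt_nil_zpow] at h3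
      rw [branchHom_apply_cons, c_eq] at h3
      simp only [TreeAut.apply_nil, branchHom_apply_cons] at h3
      simp [s₂₃, rooted] at h3

end Elements

/-! ### Proper lengths on countable groups -/

section ProperLength

variable {G : Type*} [Group G]

/-- The word length of `g` for letters of weight `w`. -/
noncomputable def wordLength (w : G → ℕ) (g : G) : ℕ :=
  sInf {n | ∃ L : List G, L.prod = g ∧ (L.map w).sum = n}

theorem exists_list_wordLength (w : G → ℕ) (g : G) :
    ∃ L : List G, L.prod = g ∧ (L.map w).sum = wordLength w g :=
  Nat.sInf_mem (s := {n | ∃ L : List G, L.prod = g ∧ (L.map w).sum = n}) ⟨_, [g], by simp, rfl⟩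

theorem wordLength_le (w : G → ℕ) (L : List G) : wordLength w L.prod ≤ (L.map w).sum :=
  Nat.sInf_le ⟨L, rfl, rfl⟩

theorem finite_prod_weight_le (w : G → ℕ) (hw : ∀ g, 0 < w g) (hf : ∀ n, {g | w g ≤ n}.Finite)
    (n : ℕ) : {g | ∃ L : List G, L.prod = g ∧ (L.map w).sum ≤ n}.Finite := by
  induction n with
  | zero =>
    refine (Set.finite_singleton (1 : G)).subset ?_
    rintro g ⟨L, rfl, h⟩
    cases L with
    | nil => simp
    | cons a L =>
      have := hw a
      simp only [List.map_cons, List.sum_cons] at h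
      omega
  | succ n ih =>
    refine ((Set.finite_singleton (1 : G)).union
      (Set.Finite.image2 (fun a b => a * b) (hf (n + 1)) ih)).subset ?_
    rintro g ⟨L, rfl, h⟩
    cases L with
    | nil => simp
    | cons a L =>
      have := hw a
      simp only [List.map_cons, List.sum_cons] at h
      refine Or.inr ⟨a, ?_, L.prod, ⟨L, rfl, ?_⟩, by simp⟩
      · change w a ≤ n + 1
        omega
      · omega

/-- The word length for positive symmetric weights as a length function. -/
noncomputable def wordNorm (w : G → ℕ) (hw : ∀ g, 0 < w g) (hi : ∀ g, w g⁻¹ = w g) :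
    GroupNorm G where
  toFun g := wordLength w g
  map_one' := by
    have := wordLength_le w []
    simpa using this
  mul_le' g h := by
    obtain ⟨L, rfl, hL⟩ := exists_list_wordLength w g
    obtain ⟨L', rfl, hL'⟩ := exists_list_wordLength w h
    rw [← hL, ← hL', ← List.prod_append]
    have := wordLength_le w (L ++ L')
    rw [List.map_append, List.sum_append] at this
    exact_mod_cast this
  inv' g := by
    have key (g : G) : wordLength w g⁻¹ ≤ wordLength w g := by
      obtain ⟨L, rfl, hL⟩ := exists_list_wordLength w g
      rw [← hL, List.prod_inv_reverse]
      refine (wordLength_le w _).trans (le_of_eq ?_)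
      rw [List.map_reverse, List.sum_reverse, List.map_map]
      congr 2
      funext a
      exact hi a
    refine congrArg _ (le_antisymm (key g) ?_)
    simpa using key g⁻¹
  eq_one_of_map_eq_zero' g h := by
    obtain ⟨L, rfl, hL⟩ := exists_list_wordLength w g
    have h : wordLength w L.prod = 0 := by exact_mod_cast h
    rw [h] at hL
    cases L with
    | nil => simp
    | cons a L =>
      have := hw a
      simp only [List.map_cons, List.sum_cons] at hL
      omega

theorem exists_properLength [Countable G] : ∃ l : GroupNorm G, IsProperLength l := by
  obtain ⟨e, he⟩ := exists_injective_nat G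
  -- The `1` makes weights positive, the two summands make them symmetric, and injectivity of `e`
  -- makes their sublevel sets finite.
  set w : G → ℕ := fun g => 1 + (e g + e g⁻¹) with hw
  refine ⟨wordNorm w (fun g => by simp only [hw]; omega)
    (fun g => by simp only [hw, inv_inv]; omega), fun R => ?_⟩
  refine (finite_prod_weight_le w (fun g => by simp only [hw]; omega) (fun n => ?_) ⌊R⌋₊).subset ?_
  · refine ((Set.finite_Iic n).preimage he.injOn).subset fun g hg => ?_
    have hg : 1 + (e g + e g⁻¹) ≤ n := hg
    change e g ≤ n
    omega
  · intro g hg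
    obtain ⟨L, h1, h2⟩ := exists_list_wordLength w g
    refine ⟨L, h1, h2.trans_le ?_⟩
    exact Nat.le_floor hg

end ProperLength

/-! ### Cosets and decomposition complexity -/

section Cosets

variable {G : Type} [Group G]

/-- The family of the right cosets of a subgroup. -/
def rightCosets (H : Subgroup G) : Set (Set G) :=
  Set.range fun x : G => {g | g * x⁻¹ ∈ H}

variable (l : GroupNorm G)

/-- The right cosets of `H` form a family in `𝔇_k`. -/
def CosetsInD (H : Subgroup G) (k : ℕ) : Prop :=
  letI : MetricSpace G := lengthMetric l
  FamilyInD (k : Ordinal.{0}) (rightCosets H)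

theorem cosetsInD_bot : CosetsInD l ⊥ 0 := by
  let : MetricSpace G := lengthMetric l
  change FamilyInD ((0 : ℕ) : Ordinal.{0}) (rightCosets (⊥ : Subgroup G))
  rw [Nat.cast_zero, familyInD_zero]
  refine ⟨0, ?_⟩
  rintro _ ⟨x, rfl⟩ y hy z hz
  have hy : y = x := mul_inv_eq_one.1 (Subgroup.mem_bot.1 hy)
  have hz : z = x := mul_inv_eq_one.1 (Subgroup.mem_bot.1 hz)
  rw [hy, hz, dist_self]

variable {l}

theorem CosetsInD.mono {H : Subgroup G} {k m : ℕ} (hkm : k ≤ m) (h : CosetsInD l H k) :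
    CosetsInD l H m :=
  letI : MetricSpace G := lengthMetric l
  FamilyInD.mono (by exact_mod_cast hkm) h

theorem exists_mul_zpow_mem_of_mem_sup_zpowers {H : Subgroup G} {a : G}
    (ha : a ∈ Subgroup.normalizer (H : Set G)) {g : G} (hg : g ∈ H ⊔ Subgroup.zpowers a) :
    ∃ i : ℤ, g * a ^ (-i) ∈ H := by
  have h1 := hg
  have h2 : Subgroup.zpowers a ≤ Subgroup.normalizer (H : Set G) := by rwa [Subgroup.zpowers_le]
  rw [sup_comm, ← SetLike.mem_coe, Subgroup.coe_mul_of_left_le_normalizer_right _ _ h2] at h1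
  obtain ⟨_, ⟨i, rfl⟩, h, hh, rfl⟩ := h1
  refine ⟨i, ?_⟩
  have := (Subgroup.mem_normalizer_iff.1 (h2 (Subgroup.zpow_mem_zpowers a i)) h).1 hh
  rwa [← zpow_neg] at this

/-- An extension by a cyclic group raises the decomposition complexity by at most one. -/
theorem CosetsInD.sup_zpowers {H : Subgroup G} {k : ℕ} (hP : CosetsInD l H k)
    (hl : IsProperLength l) {a : G} (ha : a ∈ Subgroup.normalizer (H : Set G)) :
    CosetsInD l (H ⊔ Subgroup.zpowers a) (k + 1) := by
  let : MetricSpace G := lengthMetric l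
  have hdist (g h : G) : dist g h = l (g * h⁻¹) := rfl
  set K := H ⊔ Subgroup.zpowers a with hKdef
  have hHK : H ≤ K := le_sup_left
  have haK (i : ℤ) : a ^ i ∈ K := Subgroup.zpow_mem _ (le_sup_right (a := H)
    (Subgroup.mem_zpowers a)) i
  have hconj (i : ℤ) (h : G) : h ∈ H ↔ a ^ i * h * (a ^ i)⁻¹ ∈ H :=
    Subgroup.mem_normalizer_iff.1 (Subgroup.zpow_mem _ ha i) h
  -- blocks `⋃ i < L, H a ^ i z`
  let block (L : ℕ) (z : G) : Set G := {g | ∃ i : ℕ, i < L ∧ g * (a ^ (i : ℤ) * z)⁻¹ ∈ H}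
  -- Left multiplication by `a ^ (-i)` displaces points by `l (a ^ i)` and carries `H a ^ i z` to `H
  -- z`, because `a` normalizes `H`.
  have near (L : ℕ) : ∃ B : ℝ, ∀ z, ∀ x ∈ block L z, ∃ y, y * z⁻¹ ∈ H ∧ dist x y ≤ B := by
    refine ⟨∑ i ∈ Finset.range L, l (a ^ (i : ℤ)), ?_⟩
    rintro z x ⟨i, hi, hx⟩
    refine ⟨(a ^ (i : ℤ))⁻¹ * x, ?_, ?_⟩
    · rw [hconj i]
      convert hx using 1
      group
    · rw [hdist]
      have e : x * ((a ^ (i : ℤ))⁻¹ * x)⁻¹ = a ^ (i : ℤ) := by group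
      rw [e]
      exact Finset.single_le_sum (f := fun i : ℕ => l (a ^ (i : ℤ)))
        (fun _ _ => apply_nonneg l _) (Finset.mem_range.2 hi)
  have blocksInD (L : ℕ) : FamilyInD (k : Ordinal.{0}) (Set.range (block L)) := by
    obtain ⟨B, hB⟩ := near L
    refine FamilyInD.of_neighbourhoods B _ hP ?_
    rintro _ ⟨z, rfl⟩
    exact ⟨_, ⟨z, rfl⟩, hB z⟩
  -- If a positive power of `a` lies in `H`, each coset of `K` is one block and nothing is lost.
  -- Otherwise the quotient `K / H` is infinite cyclic and is cut into intervals.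
  by_cases hfin : ∃ p : ℕ, 0 < p ∧ a ^ (p : ℤ) ∈ H
  · obtain ⟨p, hp, hpH⟩ := hfin
    refine CosetsInD.mono (Nat.le_succ k) ?_
    obtain ⟨B, hB⟩ := near p
    refine FamilyInD.of_neighbourhoods B _ hP ?_
    rintro _ ⟨z, rfl⟩
    refine ⟨_, ⟨z, rfl⟩, fun x hx => hB z x ?_⟩
    obtain ⟨i, hi⟩ := exists_mul_zpow_mem_of_mem_sup_zpowers ha hx
    have hp0 : (p : ℤ) ≠ 0 := by exact_mod_cast hp.ne'
    have hm := Int.emod_nonneg i hp0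
    refine ⟨(i % p).toNat, ?_, ?_⟩
    · have := Int.emod_lt_of_pos i (by exact_mod_cast hp : (0 : ℤ) < p)
      omega
    · rw [Int.toNat_of_nonneg hm]
      have e : x * (a ^ (i % (p : ℤ)) * z)⁻¹ = (x * z⁻¹ * a ^ (-i)) * (a ^ (p : ℤ)) ^ (i / p) := by
        rw [← zpow_mul, mul_inv_rev, mul_assoc _ (a ^ (-i)), ← zpow_add]
        conv_rhs => rw [show -i + p * (i / p) = -(i % p) by have := Int.emod_add_mul_ediv i p; linarith]
        group
      rw [e]
      exact H.mul_mem hi (H.zpow_mem hpH _)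
  · have huniq (i : ℤ) (hi : a ^ i ∈ H) : i = 0 := by
      by_contra hne
      refine hfin ⟨i.natAbs, Int.natAbs_pos.2 hne, ?_⟩
      rcases Int.natAbs_eq i with h | h
      · rwa [← h]
      · rw [show (i.natAbs : ℤ) = -i by omega, zpow_neg]
        exact H.inv_mem hi
    change FamilyInD ((k + 1 : ℕ) : Ordinal.{0}) (rightCosets K)
    rw [familyInD_of_pos (by exact_mod_cast Nat.succ_pos k)]
    intro r hr
    -- An element lies in `H a ^ i` for at most one `i`, and the ball of radius `r + 1` is finite,
    -- so the exponents occurring there are bounded.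
    obtain ⟨L, hL0, hL⟩ : ∃ L : ℕ, 0 < L ∧
        ∀ g : G, l g ≤ r + 1 → ∀ i : ℤ, g * a ^ (-i) ∈ H → |i| < L := by
      have hbd (g : G) : ∃ n : ℕ, ∀ i : ℤ, g * a ^ (-i) ∈ H → |i| < n := by
        by_cases h : ∃ j : ℤ, g * a ^ (-j) ∈ H
        · obtain ⟨j, hj⟩ := h
          refine ⟨j.natAbs + 1, fun i hi => ?_⟩
          have h1 := H.mul_mem (H.inv_mem hi) hj
          have e : (g * a ^ (-i))⁻¹ * (g * a ^ (-j)) = a ^ (i - j) := by group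
          rw [e] at h1
          have := huniq _ h1
          rw [show i = j by omega, Int.abs_eq_natAbs]
          omega
        · exact ⟨0, fun i hi => (h ⟨i, hi⟩).elim⟩
      choose n hn using hbd
      obtain ⟨N, hN⟩ := ((hl (r + 1)).image n).bddAbove
      refine ⟨N + 1, Nat.succ_pos N, fun g hg i hi => (hn g i hi).trans_le ?_⟩
      have := hN (Set.mem_image_of_mem n (show g ∈ {g | l g ≤ r + 1} from hg))
      exact_mod_cast this.trans (Nat.le_succ N)
    refine ⟨k, by exact_mod_cast Nat.lt_succ_self k, Set.range (block L), blocksInD L, ?_⟩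
    rintro _ ⟨x, rfl⟩
    have hLz : (0 : ℤ) < L := by exact_mod_cast hL0
    -- Intervals of length `L`, sorted by parity (`e = 0, 1`): exponents in two different intervals
    -- of equal parity differ by more than `L`.
    let fam (e : ℤ) : Set (Set G) := Set.range fun m : ℤ => block L (a ^ ((2 * m + e) * L) * x)
    have mem_block (q : ℤ) (y : G) : y ∈ block L (a ^ (q * L) * x) ↔
        ∃ i : ℕ, i < L ∧ y * x⁻¹ * a ^ (-(i + q * L)) ∈ H := by
      change (∃ i : ℕ, i < L ∧ y * (a ^ (i : ℤ) * (a ^ (q * L) * x))⁻¹ ∈ H) ↔ _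
      refine exists_congr fun i => and_congr_right fun _ => ?_
      rw [show y * (a ^ (i : ℤ) * (a ^ (q * L) * x))⁻¹ = y * x⁻¹ * a ^ (-(i + q * L)) by
        rw [zpow_neg, zpow_add]; group]
    have hfam (e : ℤ) : RDisjoint r (fam e) := by
      rintro _ ⟨m, rfl⟩ _ ⟨m', rfl⟩ hne
      have hmm : m ≠ m' := fun h => hne (by rw [h])
      refine lt_setDist hr.le (lt_add_one r) fun y hy z hz => ?_
      obtain ⟨i, hi, hy⟩ := (mem_block _ _).1 hy
      obtain ⟨j, hj, hz⟩ := (mem_block _ _).1 hz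
      by_contra hlt
      have h1 := hL (y * z⁻¹) (not_le.1 hlt).le ((i + (2 * m + e) * L) - (j + (2 * m' + e) * L)) (by
        set p := (i : ℤ) + (2 * m + e) * L
        set q := (j : ℤ) + (2 * m' + e) * L
        have h2 := (hconj (p - q) _).1 (H.inv_mem hz)
        have h3 := H.mul_mem hy h2
        convert h3 using 1
        rw [zpow_sub]
        group)
      have h2 : (i + (2 * m + e) * L) - (j + (2 * m' + e) * L) = (i - j : ℤ) + 2 * (m - m') * L := by
        ring
      rw [h2, abs_lt] at h1
      have hi' : (i : ℤ) < L := by exact_mod_cast hi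
      have hj' : (j : ℤ) < L := by exact_mod_cast hj
      rcases lt_or_gt_of_ne hmm with h | h
      · nlinarith [h1.1]
      · nlinarith [h1.2]
    refine ⟨⋃₀ fam 0, ⋃₀ fam 1, ?_, ⟨fam 0, ?_, hfam 0, rfl⟩, ⟨fam 1, ?_, hfam 1, rfl⟩⟩
    · have hsub (q : ℤ) (y : G) (hy : y ∈ block L (a ^ (q * L) * x)) : y * x⁻¹ ∈ K := by
        obtain ⟨i, -, hy⟩ := (mem_block _ _).1 hy
        have := K.mul_mem (hHK hy) (haK (i + q * L))
        rwa [mul_assoc, ← zpow_add, neg_add_cancel, zpow_zero, mul_one] at this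
      refine Set.Subset.antisymm (fun y hy => ?_) ?_
      · obtain ⟨i, hi⟩ := exists_mul_zpow_mem_of_mem_sup_zpowers ha hy
        have hb : y ∈ block L (a ^ (i / L * L) * x) := by
          refine (mem_block _ _).2 ⟨(i % L).toNat, ?_, ?_⟩
          · have := Int.emod_lt_of_pos i hLz
            have := Int.emod_nonneg i hLz.ne'
            omega
          · rw [Int.toNat_of_nonneg (Int.emod_nonneg i hLz.ne')]
            rwa [mul_comm (i / (L : ℤ)), Int.emod_add_mul_ediv]
        rcases Int.even_or_odd' (i / L) with ⟨m, hm | hm⟩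
        · exact Or.inl ⟨_, ⟨m, rfl⟩, by simpa [hm] using hb⟩
        · exact Or.inr ⟨_, ⟨m, rfl⟩, by simpa [hm] using hb⟩
      · rintro y (⟨_, ⟨m, rfl⟩, hy⟩ | ⟨_, ⟨m, rfl⟩, hy⟩)
        · exact hsub _ y hy
        · exact hsub _ y hy
    · rintro _ ⟨m, rfl⟩
      exact ⟨_, rfl⟩
    · rintro _ ⟨m, rfl⟩
      exact ⟨_, rfl⟩

/-- A union of a directed family of subgroups all of whose coset families have finite
complexity belongs to `𝔇_ω`. -/
theorem spaceInD_omega (hl : IsProperLength l) (H : ℕ → Subgroup G) (k : ℕ → ℕ)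
    (hmono : Monotone H) (hcov : ∀ g, ∃ n, g ∈ H n) (hH : ∀ n, CosetsInD l (H n) (k n)) :
    letI : MetricSpace G := lengthMetric l
    SpaceInD G Ordinal.omega0 := by
  let : MetricSpace G := lengthMetric l
  change FamilyInD _ _
  rw [familyInD_of_pos Ordinal.omega0_pos]
  intro r hr
  obtain ⟨n, hn⟩ : ∃ n, ∀ g, l g ≤ r + 1 → g ∈ H n := by
    choose m hm using hcov
    obtain ⟨N, hN⟩ := ((hl (r + 1)).image m).bddAbove
    exact ⟨N, fun g hg => hmono (hN (Set.mem_image_of_mem m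
      (show g ∈ {g | l g ≤ r + 1} from hg))) (hm g)⟩
  refine ⟨k n, Ordinal.natCast_lt_omega0 _, rightCosets (H n), hH n, ?_⟩
  -- Points at distance at most `r + 1` differ by an element of `H n`, hence lie in the same coset.
  have hdis : RDisjoint r (rightCosets (H n)) := by
    rintro _ ⟨x, rfl⟩ _ ⟨x', rfl⟩ hne
    refine lt_setDist hr.le (lt_add_one r) fun y hy z hz => ?_
    by_contra hlt
    have h1 := hn (y * z⁻¹) (not_le.1 hlt).le
    have hy : y * x⁻¹ ∈ H n := hy
    have hz : z * x'⁻¹ ∈ H n := hz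
    have h2 : x * x'⁻¹ ∈ H n := by
      have := (H n).mul_mem ((H n).mul_mem ((H n).inv_mem hy) h1) hz
      convert this using 1
      group
    refine hne (Set.ext fun w => ?_)
    change w * x⁻¹ ∈ H n ↔ w * x'⁻¹ ∈ H n
    rw [← (H n).mul_mem_cancel_right h2]
    exact iff_of_eq (congrArg (· ∈ H n) (by group))
  have hU : ⋃₀ rightCosets (H n) = Set.univ :=
    Set.eq_univ_of_forall fun y => ⟨{g | g * y⁻¹ ∈ H n}, ⟨y, rfl⟩, by
      change y * y⁻¹ ∈ H n
      rw [mul_inv_cancel]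
      exact one_mem _⟩
  rintro _ rfl
  exact ⟨Set.univ, Set.univ, (Set.union_self _).symm, ⟨_, subset_rfl, hdis, hU.symm⟩,
    ⟨_, subset_rfl, hdis, hU.symm⟩⟩

theorem CosetsInD.spaceInD {k : ℕ} (h : CosetsInD l (⊤ : Subgroup G) k) :
    letI : MetricSpace G := lengthMetric l
    SpaceInD G (k : Ordinal.{0}) := by
  let : MetricSpace G := lengthMetric l
  have e : rightCosets (⊤ : Subgroup G) = {Set.univ} := by
    ext A
    constructor
    · rintro ⟨x, rfl⟩
      exact Set.eq_univ_of_forall fun _ => Subgroup.mem_top _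
    · rintro rfl
      exact ⟨1, Set.eq_univ_of_forall fun _ => Subgroup.mem_top _⟩
  change FamilyInD _ _
  rw [← e]
  exact h

end Cosets

/-! ### Infinite asymptotic dimension -/

section Asdim

open Finsupp

theorem infiniteAsdim_of_injective {G : Type} [Group G] {l : GroupNorm G} (hl : IsProperLength l)
    (f : Multiplicative (ℕ →₀ ℤ) →* G) (hf : Function.Injective f) :
    letI : MetricSpace G := lengthMetric l
    InfiniteAsdim G := by
  let : MetricSpace G := lengthMetric l
  have hdist (g h : G) : dist g h = l (g * h⁻¹) := rfl
  intro n hn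
  let κ : (ℕ →₀ ℕ) →+ (ℕ →₀ ℤ) := Finsupp.mapRange.addMonoidHom (Nat.castAddMonoidHom ℤ)
  have hκ (x : ℕ →₀ ℕ) (j : ℕ) : κ x j = (x j : ℤ) := rfl
  let F : (ℕ →₀ ℕ) → G := fun x => f (Multiplicative.ofAdd (κ x))
  have hF (x y : ℕ →₀ ℕ) : F x * (F y)⁻¹ = f (Multiplicative.ofAdd (κ x - κ y)) := by
    rw [ofAdd_sub, div_eq_mul_inv, map_mul, map_inv]
  let S := Finset.range (n + 1)
  -- `δ` bounds the diameters of the images of unit cubes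
  obtain ⟨δ, hδ0, hδ⟩ : ∃ δ : ℝ, 0 ≤ δ ∧ ∀ x : ℕ →₀ ℕ, ∀ A ⊆ S, ∀ B ⊆ S,
      dist (F (x + ∑ i ∈ A, single i 1)) (F (x + ∑ i ∈ B, single i 1)) ≤ δ := by
    let D (A B : Finset ℕ) : ℝ := l (F (∑ i ∈ A, single i 1) * (F (∑ i ∈ B, single i 1))⁻¹)
    have hD (A B : Finset ℕ) : 0 ≤ D A B := apply_nonneg l _
    refine ⟨∑ A ∈ S.powerset, ∑ B ∈ S.powerset, D A B,
      Finset.sum_nonneg fun A _ => Finset.sum_nonneg fun B _ => hD A B, fun x A hA B hB => ?_⟩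
    -- The metric is translation invariant on the image of `F`, so the base point `x` drops out.
    have e : dist (F (x + ∑ i ∈ A, single i 1)) (F (x + ∑ i ∈ B, single i 1)) = D A B := by
      simp only [D]
      rw [hdist, hF, hF, map_add, map_add, add_sub_add_left_eq_sub]
    rw [e]
    refine (Finset.single_le_sum (f := fun B => D A B) (fun B _ => hD A B)
      (Finset.mem_powerset.2 hB)).trans ?_
    exact Finset.single_le_sum (f := fun A => ∑ B ∈ S.powerset, D A B)
      (fun A _ => Finset.sum_nonneg fun B _ => hD A B) (Finset.mem_powerset.2 hA)
  -- Scale chosen so that same-coloured sets with points within `2 * δ` of each other coincide.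
  obtain ⟨𝒰, hcov, hdis, B, hB⟩ := hn (2 * δ + 1) (by positivity)
  -- Colours beyond `n` are empty; this only makes the index type `ℕ`.
  let 𝒱 (j : ℕ) : Set (Set G) := if h : j < n + 1 then 𝒰 ⟨j, h⟩ else ∅
  have h𝒱dis (j : ℕ) : RDisjoint (2 * δ + 1) (𝒱 j) := by
    by_cases h : j < n + 1
    · simp only [𝒱, dif_pos h]; exact hdis _
    · simp only [𝒱, dif_neg h]; rintro U ⟨⟩
  have h𝒱B (j : ℕ) : ∀ U ∈ 𝒱 j, ∀ x ∈ U, ∀ y ∈ U, dist x y ≤ B := by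
    by_cases h : j < n + 1
    · simp only [𝒱, dif_pos h]
      exact fun U hU => hB U (Set.mem_iUnion.2 ⟨_, hU⟩)
    · simp only [𝒱, dif_neg h]; rintro U ⟨⟩
  let Hs (j : ℕ) : Set G := F '' {x | x j = 0}
  -- The wall `x j = 0` together with the `δ`-neighbourhoods of the sets of colour `j` that come
  -- within `δ` of it.
  let W (j : ℕ) : Set G := Hs j ∪ {g | ∃ V ∈ 𝒱 j, (∃ v ∈ V, dist g v ≤ δ) ∧
    ∃ v ∈ V, ∃ h ∈ Hs j, dist v h ≤ δ}
  -- points near the boundary of `W j` are not of colour `j`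
  have hbdry (j : ℕ) (x y z : G) (hxy : dist x y ≤ δ) (hyz : dist y z ≤ δ) (hxz : dist x z ≤ δ)
      (hx : x ∈ W j) (hy : y ∉ W j) : z ∉ ⋃₀ 𝒱 j := by
    rintro ⟨V, hV, hz⟩
    rcases hx with hx | ⟨V', hV', ⟨v', hv', hxv⟩, hH⟩
    · exact hy (Or.inr ⟨V, hV, ⟨z, hz, hyz⟩, z, hz, x, hx, by rwa [dist_comm]⟩)
    · have hzv : dist z v' ≤ 2 * δ + 1 := by
        have := dist_triangle z x v'
        rw [dist_comm z x] at this
        linarith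
      obtain rfl := (h𝒱dis j).eq_of_dist_le hV hV' hz hv' hzv
      exact hy (Or.inr ⟨V, hV, ⟨z, hz, hyz⟩, hH⟩)
  -- Points of `W j` are within `2 * δ + |B|` of the wall, and by properness only finitely many
  -- lattice vectors are that short, so `W j` misses a far parallel face.
  obtain ⟨k, hk⟩ : ∃ k : ℕ, ∀ j ∈ S, ∀ x : ℕ →₀ ℕ, F x ∈ W j → x j < k := by
    have hfin : {z : ℕ →₀ ℤ | l (f (Multiplicative.ofAdd z)) ≤ 2 * δ + |B|}.Finite :=
      (hl (2 * δ + |B|)).preimage (hf.comp Multiplicative.ofAdd.injective).injOn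
    obtain ⟨N, hN⟩ := (hfin.image fun z => ∑ j ∈ S, (z j).natAbs).bddAbove
    refine ⟨N + 1, fun j hj x hx => ?_⟩
    obtain ⟨y, hy0, hxy⟩ : ∃ y : ℕ →₀ ℕ, y j = 0 ∧ dist (F x) (F y) ≤ 2 * δ + |B| := by
      rcases hx with ⟨y, hy, e⟩ | ⟨V, hV, ⟨v, hv, hxv⟩, v', hv', _, ⟨y, hy, rfl⟩, hvy⟩
      · exact ⟨y, hy, by rw [e, dist_self]; positivity⟩
      · refine ⟨y, hy, ?_⟩
        have := dist_triangle4 (F x) v v' (F y)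
        have := h𝒱B j V hV v hv v' hv'
        have := le_abs_self B
        linarith
    rw [hdist, hF] at hxy
    have h1 := hN (Set.mem_image_of_mem _ (show κ x - κ y ∈
      {z : ℕ →₀ ℤ | l (f (Multiplicative.ofAdd z)) ≤ 2 * δ + |B|} from hxy))
    have h2 := (Finset.single_le_sum (f := fun j => ((κ x - κ y) j).natAbs)
      (fun _ _ => Nat.zero_le _) hj).trans h1
    simp only [Finsupp.sub_apply, hκ, hy0] at h2
    omega
  -- The cube at `x` straddles the boundary of every `W j`, so by `hbdry` the point `F x` has no
  -- colour, although the sets cover.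
  obtain ⟨x, hx⟩ := exists_cube_meeting_boundaries S (fun j => F ⁻¹' W j) k
    (fun j _ x hx => Or.inl ⟨x, hx, rfl⟩) (fun j hj x hx h => (hk j hj x h).ne hx)
  have hmem : F x ∈ ⋃ i, ⋃₀ 𝒰 i := by rw [hcov]; trivial
  obtain ⟨⟨j, hj⟩, hxj⟩ := Set.mem_iUnion.1 hmem
  obtain ⟨A, hA, A', hA', h1, h2⟩ := hx j (Finset.mem_range.2 hj)
  have h3 := hδ x A hA ∅ (Finset.empty_subset S)
  have h4 := hδ x A' hA' ∅ (Finset.empty_subset S)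
  rw [Finset.sum_empty, add_zero] at h3 h4
  refine hbdry j _ _ (F x) (hδ x A hA A' hA') h4 h3 h1 h2 ?_
  simp only [𝒱, dif_pos hj]
  exact hxj

end Asdim

/-! ### The group `T` lies in the mother group -/

section Membership

/-- The subgroup of the mother group generated by the rooted automorphisms and by the directed
automorphisms with a single nontrivial rooted restriction. -/
def thinMotherGroup : Subgroup (TreeAut (Fin 3)) :=
  Subgroup.closure (Set.range (rooted (X := Fin 3)) ∪
    ((Set.range fun e => directed (n := 2) ![e, 1] 1) ∪
      Set.range fun e => directed (n := 2) ![1, e] 1))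

theorem thinMotherGroup_le : thinMotherGroup ≤ G₃ := by
  refine Subgroup.closure_mono (Set.union_subset_union_right _ ?_)
  rintro _ (⟨e, rfl⟩ | ⟨e, rfl⟩)
  · exact ⟨_, _, rfl⟩
  · exact ⟨_, _, rfl⟩

theorem rooted_mem_thin (a : Equiv.Perm (Fin 3)) : rooted a ∈ thinMotherGroup :=
  Subgroup.subset_closure (Or.inl ⟨a, rfl⟩)

theorem branchHom_comp_mem_thin {g : Fin 3 → TreeAut (Fin 3)}
    (hg : branchHom g ∈ thinMotherGroup) (a : Equiv.Perm (Fin 3)) :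
    branchHom (g ∘ a) ∈ thinMotherGroup := by
  have := rooted_mul_branchHom a.symm g
  rw [Equiv.symm_symm] at this
  rw [← this]
  exact mul_mem (mul_mem (rooted_mem_thin _) hg) (inv_mem (rooted_mem_thin _))

/-- The thin generators are used because each has a trivial restriction, which a permutation of
coordinates moves to the last place. General directed automorphisms may have none. -/
theorem exists_lift {g : TreeAut (Fin 3)} (hg : g ∈ thinMotherGroup) :
    ∃ p, branchHom ![g, p, 1] ∈ thinMotherGroup := by
  have perm3 {x y z : TreeAut (Fin 3)} (h : branchHom ![x, y, z] ∈ thinMotherGroup)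
      (a : Equiv.Perm (Fin 3)) : branchHom (![x, y, z] ∘ a) ∈ thinMotherGroup :=
    branchHom_comp_mem_thin h a
  have hdir (e : Equiv.Perm (Fin 3)) :
      branchHom ![rooted e, 1, directed (n := 2) ![e, 1] 1] ∈ thinMotherGroup := by
    have h1 := directed_one_eq ![e, 1]
    have h2 : directed (n := 2) ![e, 1] 1 ∈ thinMotherGroup :=
      Subgroup.subset_closure (Or.inr (Or.inl ⟨e, rfl⟩))
    rw [h1] at h2
    simpa [rooted_one] using h2
  have hdir' (e : Equiv.Perm (Fin 3)) :
      branchHom ![1, rooted e, directed (n := 2) ![1, e] 1] ∈ thinMotherGroup := by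
    have h1 := directed_one_eq ![1, e]
    have h2 : directed (n := 2) ![1, e] 1 ∈ thinMotherGroup :=
      Subgroup.subset_closure (Or.inr (Or.inr ⟨e, rfl⟩))
    rw [h1] at h2
    simpa [rooted_one] using h2
  induction hg using Subgroup.closure_induction with
  | mem g hg =>
    rcases hg with ⟨e, rfl⟩ | ⟨e, rfl⟩ | ⟨e, rfl⟩
    · refine ⟨directed (n := 2) ![e, 1] 1, ?_⟩
      have := perm3 (hdir e) (Equiv.swap 1 2)
      convert this using 2
      funext i
      fin_cases i <;> rfl
    · refine ⟨rooted e, ?_⟩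
      have := perm3 (hdir e) (Equiv.swap 0 1 * Equiv.swap 0 2)
      convert this using 2
      funext i
      fin_cases i <;> rfl
    · refine ⟨rooted e, ?_⟩
      have := perm3 (hdir' e) (Equiv.swap 0 2)
      convert this using 2
      funext i
      fin_cases i <;> rfl
  | one => exact ⟨1, by
      convert one_mem thinMotherGroup
      have e : (![1, 1, 1] : Fin 3 → TreeAut (Fin 3)) = 1 := by
        funext i
        fin_cases i <;> rfl
      rw [e, map_one]⟩
  | mul g h _ _ hg hh =>
    obtain ⟨p, hp⟩ := hg
    obtain ⟨q, hq⟩ := hh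
    refine ⟨p * q, ?_⟩
    convert mul_mem hp hq using 1
    rw [← map_mul]
    congr 1
    funext i
    fin_cases i <;> simp
  | inv g _ hg =>
    obtain ⟨p, hp⟩ := hg
    refine ⟨p⁻¹, ?_⟩
    convert inv_mem hp using 1
    rw [← map_inv]
    congr 1
    funext i
    fin_cases i <;> simp

theorem atVertex_commutator {x : Fin 3} {g h : TreeAut (Fin 3)} (hg : g ∈ thinMotherGroup)
    (hh : h ∈ thinMotherGroup) :
    ∃ g' ∈ thinMotherGroup, ∃ h' ∈ thinMotherGroup, 
      atVertex x (g * h * g⁻¹ * h⁻¹) = g' * h' * g'⁻¹ * h'⁻¹ := by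
  obtain ⟨p, hp⟩ := exists_lift hg
  obtain ⟨q, hq⟩ := exists_lift hh
  have hq' : branchHom ![h, 1, q] ∈ thinMotherGroup := by
    convert branchHom_comp_mem_thin hq (Equiv.swap 1 2) using 2
    funext i
    fin_cases i <;> rfl
  -- The commutator of `(g, p, 1)` and `(h, 1, q)` lives in the first coordinate; the swap moves it
  -- to `x`.
  refine ⟨_, branchHom_comp_mem_thin hp (Equiv.swap 0 x),
    _, branchHom_comp_mem_thin hq' (Equiv.swap 0 x), ?_⟩
  rw [atVertex_apply, ← map_inv, ← map_inv, ← map_mul,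
    ← map_mul, ← map_mul]
  congr 1
  funext i
  have key (y : Fin 3) (hy : y ≠ 0) :
      ![g, p, 1] y * ![h, 1, q] y * (![g, p, 1] y)⁻¹ * (![h, 1, q] y)⁻¹ = 1 := by
    fin_cases y
    · exact (hy rfl).elim
    · simp
    · simp
  rcases eq_or_ne i x with rfl | hne
  · simp
  · rw [Pi.mulSingle_eq_of_ne hne]
    refine (key (Equiv.swap 0 x i) fun e => hne ?_).symm
    rw [Equiv.swap_apply_eq_iff, Equiv.swap_apply_left] at e
    exact e

/-- Being a commutator, not mere membership, is what passes down the tree. -/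
theorem tElt_eq_commutator (v : List (Fin 3)) :
    ∃ g ∈ thinMotherGroup, ∃ h ∈ thinMotherGroup, tElt v = g * h * g⁻¹ * h⁻¹ := by
  induction v with
  | nil =>
    refine ⟨s₂₃, rooted_mem_thin _, c, Subgroup.subset_closure (Or.inr (Or.inr ⟨_, rfl⟩)), ?_⟩
    rw [s_inv, c_inv]; rfl
  | cons x v ih =>
    obtain ⟨g, hg, h, hh, e⟩ := ih
    rw [tElt_cons, e]
    exact atVertex_commutator hg hh

theorem tElt_mem_thin (v : List (Fin 3)) : tElt v ∈ thinMotherGroup := by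
  obtain ⟨g, hg, h, hh, e⟩ := tElt_eq_commutator v
  rw [e]
  exact mul_mem (mul_mem (mul_mem hg hh) (inv_mem hg)) (inv_mem hh)

theorem T_le : T ≤ G₃ := by
  refine le_trans ?_ thinMotherGroup_le
  rw [T, Subgroup.closure_le]
  rintro _ ⟨v, rfl⟩
  exact tElt_mem_thin v

end Membership

/-! ### The direct sum of infinitely many infinite cyclic groups in `T` -/

section DirectSum

theorem tElt_mem_T (v : List (Fin 3)) : tElt v ∈ T := Subgroup.subset_closure ⟨v, rfl⟩

/-- The vertices `3⋯31` of the tree, none of which lies below another one. -/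
def spineVertex : ℕ → List (Fin 3)
  | 0 => [0]
  | k + 1 => 2 :: spineVertex k

theorem tElt_spine_commute (j k : ℕ) :
    Commute (tElt (spineVertex j)) (tElt (spineVertex k)) := by
  induction j generalizing k with
  | zero =>
    cases k with
    | zero => exact Commute.refl _
    | succ k => exact atVertex_commute (by decide) _ _
  | succ j ih =>
    cases k with
    | zero => exact atVertex_commute (by decide) _ _
    | succ k => exact (ih k).map (atVertex 2)

theorem tElt_spine_zpow_apply (n : ℤ) (j k : ℕ) (w : List (Fin 3)) :
    (tElt (spineVertex j) ^ n).1 (spineVertex k ++ w) =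
      spineVertex k ++ (tElt [] ^ (if j = k then n else 0)).1 w := by
  induction j generalizing k with
  | zero =>
    rw [spineVertex, tElt_cons, ← map_zpow]
    cases k with
    | zero => exact atVertex_apply_same _ _ _
    | succ k => exact atVertex_apply_ne (by decide) _ _
  | succ j ih =>
    rw [spineVertex, tElt_cons, ← map_zpow]
    cases k with
    | zero => exact atVertex_apply_ne (by decide) _ _
    | succ k =>
      rw [spineVertex, List.cons_append, atVertex_apply_same, ih]
      simp

/-- The `t_v`, `v` a spine vertex, generate a direct sum of infinite cyclic groups. -/
theorem exists_directSum_hom :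
    ∃ f : Multiplicative (ℕ →₀ ℤ) →* T, Function.Injective f := by
  let a (k : ℕ) : T := ⟨tElt (spineVertex k), tElt_mem_T _⟩
  have ha : ∀ x ∈ Set.range a, ∀ y ∈ Set.range a, x * y = y * x := by
    rintro _ ⟨j, rfl⟩ _ ⟨k, rfl⟩
    exact Subtype.ext (tElt_spine_commute j k)
  -- `Finsupp.prod` needs a commutative target, so the homomorphism is first built into this
  -- closure.
  let : CommGroup (Subgroup.closure (Set.range a)) :=
    { mul_comm := (Subgroup.isMulCommutative_closure ha).is_comm.comm }
  let b (k : ℕ) : Subgroup.closure (Set.range a) := ⟨a k, Subgroup.subset_closure ⟨k, rfl⟩⟩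
  let f₀ : Multiplicative (ℕ →₀ ℤ) →* Subgroup.closure (Set.range a) :=
    { toFun x := x.toAdd.prod fun k n => b k ^ n
      map_one' := Finsupp.prod_zero_index
      map_mul' x y := Finsupp.prod_add_index' (fun k => zpow_zero (b k))
        (fun k m n => zpow_add (b k) m n) }
  -- The action below the `k`-th spine vertex reads off the `k`-th coordinate, which yields
  -- injectivity.
  have key (x : ℕ →₀ ℤ) : ∀ (k : ℕ) (w : List (Fin 3)),
      (f₀ (Multiplicative.ofAdd x)).1.1.1 (spineVertex k ++ w) =
        spineVertex k ++ (tElt [] ^ x k).1 w := by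
    induction x using Finsupp.induction_linear with
    | zero =>
      intro k w
      rw [ofAdd_zero, map_one]
      rfl
    | add x y hx hy =>
      intro k w
      rw [ofAdd_add, map_mul]
      change (f₀ (Multiplicative.ofAdd x)).1.1.1
        ((f₀ (Multiplicative.ofAdd y)).1.1.1 (spineVertex k ++ w)) = _
      rw [hy, hx, Finsupp.add_apply, zpow_add]
      rfl
    | single j n =>
      intro k w
      have e : f₀ (Multiplicative.ofAdd (Finsupp.single j n)) = b j ^ n :=
        Finsupp.prod_single_index (zpow_zero (b j))
      rw [e, Finsupp.single_apply, ← tElt_spine_zpow_apply]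
      rfl
  refine ⟨(Subgroup.closure (Set.range a)).subtype.comp f₀, ?_⟩
  rw [injective_iff_map_eq_one]
  intro x hx
  have hx : f₀ x = 1 := Subtype.ext hx
  refine Multiplicative.toAdd.injective (Finsupp.ext fun k => ?_)
  have h1 : tElt [] ^ x.toAdd k = 1 := by
    refine Subtype.ext (Equiv.ext fun w => ?_)
    have h2 := key x.toAdd k w
    rw [ofAdd_toAdd, hx] at h2
    exact (List.append_cancel_left h2).symm
  by_contra hne
  refine tElt_nil_zpow_ne_one (x.toAdd k).natAbs (Int.natAbs_ne_zero.2 hne) ?_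
  rcases Int.natAbs_eq (x.toAdd k) with h | h
  · rwa [← h]
  · rw [show ((x.toAdd k).natAbs : ℤ) = -x.toAdd k by omega, zpow_neg, h1, inv_one]

end DirectSum

/-! ### Decomposition complexity -/

section Decomposition

variable (K : Subgroup (TreeAut (Fin 3)))

/-- The subgroup of `K` generated by the `t_v ∈ K` with `v ∈ V`. -/
def tSubgroup (V : Set (List (Fin 3))) : Subgroup K :=
  Subgroup.closure {g | ∃ v ∈ V, (g : TreeAut (Fin 3)) = tElt v}

variable {K}

theorem tSubgroup_mono {V V' : Set (List (Fin 3))} (h : V ⊆ V') :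
    tSubgroup K V ≤ tSubgroup K V' :=
  Subgroup.closure_mono fun _ ⟨v, hv, e⟩ => ⟨v, h hv, e⟩

theorem mem_tSubgroup {V : Set (List (Fin 3))} {v : List (Fin 3)} (hv : v ∈ V) {g : K}
    (h : (g : TreeAut (Fin 3)) = tElt v ∨ (g : TreeAut (Fin 3)) = (tElt v)⁻¹) :
    g ∈ tSubgroup K V := by
  rcases h with h | h
  · exact Subgroup.subset_closure ⟨v, hv, h⟩
  · rw [← inv_inv g]
    refine inv_mem (Subgroup.subset_closure ⟨v, hv, ?_⟩)
    rw [Subgroup.coe_inv, h, inv_inv]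

/-- The two alternatives allow a partially filled level: generators on the level of `w` commute with
`t_w`, while complete levels at or below it are permuted up to inversion. -/
theorem mem_normalizer_tSubgroup {V : Set (List (Fin 3))} {w : List (Fin 3)}
    (h : ∀ v ∈ V, v.length = w.length ∨
      (w.length ≤ v.length ∧ ∀ v' : List (Fin 3), v'.length = v.length → v' ∈ V))
    {g : K} (hg : (g : TreeAut (Fin 3)) = tElt w) :
    g ∈ Subgroup.normalizer (tSubgroup K V : Set K) := by
  have hconj : ∀ v ∈ V, ∀ k : K, (k : TreeAut (Fin 3)) = tElt v →
      g * k * g⁻¹ ∈ tSubgroup K V ∧ g⁻¹ * k * g ∈ tSubgroup K V := by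
    intro v hv k hk
    rcases h v hv with hl | ⟨hl, hV⟩
    · have hc : g * k = k * g := by
        refine Subtype.ext ?_
        rw [Subgroup.coe_mul, Subgroup.coe_mul, hg, hk]
        exact tElt_commute hl.symm
      have hmem : k ∈ tSubgroup K V := mem_tSubgroup hv (Or.inl hk)
      refine ⟨?_, ?_⟩
      · rwa [hc, mul_inv_cancel_right]
      · rwa [mul_assoc, ← hc, inv_mul_cancel_left]
    · obtain ⟨⟨v₁, hl₁, h₁⟩, v₂, hl₂, h₂⟩ := tElt_conj w v hl
      refine ⟨mem_tSubgroup (hV v₁ hl₁) ?_, mem_tSubgroup (hV v₂ hl₂) ?_⟩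
      · simpa only [Subgroup.coe_mul, Subgroup.coe_inv, hg, hk] using h₁
      · simpa only [Subgroup.coe_mul, Subgroup.coe_inv, hg, hk] using h₂
  have hle : tSubgroup K V ≤ (tSubgroup K V).comap (MulAut.conj g).toMonoidHom :=
    (Subgroup.closure_le _).2 fun k ⟨v, hv, hk⟩ => (hconj v hv k hk).1
  have hle' : tSubgroup K V ≤ (tSubgroup K V).comap (MulAut.conj g⁻¹).toMonoidHom := by
    refine (Subgroup.closure_le _).2 fun k ⟨v, hv, hk⟩ => ?_
    change g⁻¹ * k * g⁻¹⁻¹ ∈ tSubgroup K V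
    rw [inv_inv]
    exact (hconj v hv k hk).2
  rw [Subgroup.mem_normalizer_iff]
  refine fun k => ⟨fun hk => hle hk, fun hk => ?_⟩
  have : g⁻¹ * (g * k * g⁻¹) * g⁻¹⁻¹ ∈ tSubgroup K V := hle' hk
  convert this using 1
  group

variable {l : GroupNorm K}

theorem CosetsInD.insert_tElt (hl : IsProperLength l) {V : Set (List (Fin 3))} {k : ℕ}
    (hV : CosetsInD l (tSubgroup K V) k) {w : List (Fin 3)} (hw : tElt w ∈ K)
    (h : ∀ v ∈ V, v.length = w.length ∨
      (w.length ≤ v.length ∧ ∀ v' : List (Fin 3), v'.length = v.length → v' ∈ V)) :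
    CosetsInD l (tSubgroup K (insert w V)) (k + 1) := by
  have e : tSubgroup K (insert w V) = tSubgroup K V ⊔ Subgroup.zpowers ⟨tElt w, hw⟩ := by
    rw [tSubgroup, tSubgroup, Subgroup.zpowers_eq_closure, ← Subgroup.closure_union]
    congr 1
    ext g
    simp only [Set.mem_insert_iff, Set.mem_ofPred_eq, exists_eq_or_imp, Set.mem_union,
      Set.mem_singleton_iff, Subtype.ext_iff]
    rw [or_comm]
  rw [e]
  exact hV.sup_zpowers hl (mem_normalizer_tSubgroup h rfl)

/-- Adding a whole level of the generators `t_v`. -/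
theorem CosetsInD.union_level (hl : IsProperLength l) {V : Set (List (Fin 3))} {m k : ℕ}
    (hV : CosetsInD l (tSubgroup K V) k) (hm : ∀ v : List (Fin 3), v.length = m → tElt v ∈ K)
    (h : ∀ v ∈ V, m < v.length ∧ ∀ v' : List (Fin 3), v'.length = v.length → v' ∈ V) :
    CosetsInD l (tSubgroup K (V ∪ {v | v.length = m})) (k + 3 ^ m) := by
  classical
  have key (F : Finset (List (Fin 3))) (hF : ∀ v ∈ F, v.length = m) :
      CosetsInD l (tSubgroup K (V ∪ F)) (k + F.card) := by
    induction F using Finset.induction_on with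
    | empty => simpa using hV
    | insert w F hw ih =>
      have ih := ih fun v hv => hF v (Finset.mem_insert_of_mem hv)
      have hwm := hF w (Finset.mem_insert_self w F)
      rw [Finset.card_insert_of_notMem hw, ← add_assoc, Finset.coe_insert, Set.union_insert]
      refine ih.insert_tElt hl (hm w hwm) ?_
      rintro v (hv | hv)
      · obtain ⟨h1, h2⟩ := h v hv
        exact Or.inr ⟨by omega, fun v' hv' => Or.inl (h2 v' hv')⟩
      · exact Or.inl ((hF v (Finset.mem_insert_of_mem hv)).trans hwm.symm)
  let F : Finset (List (Fin 3)) := Finset.univ.image (List.ofFn : (Fin m → Fin 3) → _)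
  have hF : (F : Set (List (Fin 3))) = {v | v.length = m} := by
    ext v
    simp only [F, Finset.coe_image, Finset.coe_univ, Set.image_univ, Set.mem_range,
      Set.mem_ofPred_eq]
    constructor
    · rintro ⟨f, rfl⟩
      exact List.length_ofFn
    · rintro rfl
      exact ⟨v.get, List.ofFn_get v⟩
  have hcard : F.card ≤ 3 ^ m := Finset.card_image_le.trans (by simp)
  rw [← hF]
  refine CosetsInD.mono (by omega) (key F fun v hv => ?_)
  have : v ∈ (F : Set (List (Fin 3))) := hv
  rwa [hF] at this

theorem cosetsInD_levels (hl : IsProperLength l) {n : ℕ}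
    (hn : ∀ v : List (Fin 3), v.length ≤ n → tElt v ∈ K) :
    CosetsInD l (tSubgroup K {v | v.length ≤ n}) (4 ^ (n + 1)) := by
  -- Here `i` counts the levels adjoined from the bottom, each charged `3 ^ n`, the size of the
  -- deepest one; for `i = 0` there are no generators.
  have key (i : ℕ) (hi : i ≤ n + 1) :
      CosetsInD l (tSubgroup K {v | n + 1 - i ≤ v.length ∧ v.length ≤ n}) (i * 3 ^ n) := by
    induction i with
    | zero =>
      have e : tSubgroup K {v | n + 1 - 0 ≤ v.length ∧ v.length ≤ n} = ⊥ := by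
        rw [tSubgroup, Subgroup.closure_eq_bot_iff]
        rintro g ⟨v, ⟨h1, h2⟩, -⟩
        omega
      rw [e, zero_mul]
      exact cosetsInD_bot l
    | succ i ih =>
      have h := (ih (by omega)).union_level hl (m := n - i)
        (fun v hv => hn v (by omega)) (fun v hv => ?_)
      · have e : {v : List (Fin 3) | n + 1 - i ≤ v.length ∧ v.length ≤ n} ∪
            {v | v.length = n - i} = {v | n + 1 - (i + 1) ≤ v.length ∧ v.length ≤ n} := by
          ext v
          simp only [Set.mem_union, Set.mem_ofPred_eq]
          omega
        rw [e] at h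
        refine h.mono ?_
        rw [add_mul, one_mul]
        gcongr
        · norm_num
        · omega
      · obtain ⟨h1, h2⟩ := hv
        refine ⟨by omega, fun v' hv' => ⟨?_, ?_⟩⟩ <;> omega
  have h := key (n + 1) le_rfl
  have e : {v : List (Fin 3) | n + 1 - (n + 1) ≤ v.length ∧ v.length ≤ n} =
      {v | v.length ≤ n} := by
    ext v
    simp
  rw [e] at h
  refine h.mono ?_
  have h4 : ∀ n : ℕ, (n + 1) * 3 ^ n ≤ 4 ^ (n + 1) := by
    intro n
    induction n with
    | zero => norm_num
    | succ n ih =>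
      have : 3 ^ (n + 1) ≤ 4 ^ (n + 1) := Nat.pow_le_pow_left (by norm_num) _
      calc (n + 1 + 1) * 3 ^ (n + 1) = 3 * ((n + 1) * 3 ^ n) + 3 ^ (n + 1) := by ring
        _ ≤ 3 * 4 ^ (n + 1) + 4 ^ (n + 1) := by gcongr
        _ = 4 ^ (n + 1 + 1) := by ring
  exact h4 n

theorem spaceInD_T (l : GroupNorm T) (hl : IsProperLength l) :
    letI : MetricSpace T := lengthMetric l
    SpaceInD T Ordinal.omega0 := by
  have hmono : Monotone fun n : ℕ => tSubgroup T {v | v.length ≤ n} := fun m n hmn =>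
    tSubgroup_mono fun v (hv : v.length ≤ m) => hv.trans hmn
  refine spaceInD_omega hl _ _ hmono ?_
    (fun n => cosetsInD_levels hl fun v _ => tElt_mem_T v)
  rintro ⟨g, hg⟩
  induction hg using Subgroup.closure_induction with
  | mem g hg =>
    obtain ⟨v, rfl⟩ := hg
    exact ⟨v.length, Subgroup.subset_closure ⟨v, le_refl v.length, rfl⟩⟩
  | one => exact ⟨0, one_mem _⟩
  | mul g h hg' hh' hg hh =>
    obtain ⟨m, hm⟩ := hg
    obtain ⟨n, hn⟩ := hh
    exact ⟨max m n, mul_mem (hmono (le_max_left m n) hm) (hmono (le_max_right m n) hn)⟩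
  | inv g hg' hg =>
    obtain ⟨m, hm⟩ := hg
    exact ⟨m, inv_mem hm⟩

theorem spaceInD_TLevel (n : ℕ) (l : GroupNorm (TLevel n)) (hl : IsProperLength l) :
    letI : MetricSpace (TLevel n) := lengthMetric l
    SpaceInD (TLevel n) ((4 ^ (n + 1) : ℕ) : Ordinal) := by
  refine CosetsInD.spaceInD ?_
  have e : tSubgroup (TLevel n) {v | v.length ≤ n} = ⊤ :=
    Subgroup.closure_closure_coe_preimage
  rw [← e]
  exact cosetsInD_levels hl fun v hv => Subgroup.subset_closure ⟨v, hv, rfl⟩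

end Decomposition

instance : Countable T := by
  rw [T, ← FreeGroup.range_lift_eq_closure]
  have : Countable (FreeGroup (List (Fin 3))) :=
    (Quot.mk_surjective (r := FreeGroup.Red.Step)).countable
  exact (FreeGroup.lift tElt).rangeRestrict_surjective.countable

end MotherFDC

theorem theorem4p9 :
    MotherFDC.T ≤ MotherFDC.G₃ ∧
    (∃ l : GroupNorm MotherFDC.T, MotherFDC.IsProperLength l) ∧
    (∀ l : GroupNorm MotherFDC.T, MotherFDC.IsProperLength l →
      letI : MetricSpace MotherFDC.T := MotherFDC.lengthMetric l
      MotherFDC.HasFDC MotherFDC.T ∧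
      MotherFDC.SpaceInD MotherFDC.T Ordinal.omega0 ∧
      MotherFDC.InfiniteAsdim MotherFDC.T) ∧
    (∀ (n : ℕ) (l : GroupNorm (MotherFDC.TLevel n)), MotherFDC.IsProperLength l →
      letI : MetricSpace (MotherFDC.TLevel n) := MotherFDC.lengthMetric l
      MotherFDC.SpaceInD (MotherFDC.TLevel n) ((4 ^ (n + 1) : ℕ) : Ordinal)) ∧
    (∃ f : Multiplicative (ℕ →₀ ℤ) →* MotherFDC.T, Function.Injective f) := by
  obtain ⟨f, hf⟩ := MotherFDC.exists_directSum_hom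
  refine ⟨MotherFDC.T_le, MotherFDC.exists_properLength, fun l hl => ?_,
    MotherFDC.spaceInD_TLevel, f, hf⟩
  exact ⟨⟨_, MotherFDC.spaceInD_T l hl⟩, MotherFDC.spaceInD_T l hl,
    MotherFDC.infiniteAsdim_of_injective hl f hf⟩
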